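/- Let \(\square_{\omega_1}\) be the principle: there is a sequence \(\langle C_\alpha:\alpha<\omega_2,\ \alpha\text{ limit}\rangle\) such that (i) \(C_\alpha\) is a closed unbounded subset of \(\alpha\); (ii) if \(\operatorname{cf}(\alpha)=\omega\), then \(|C_\alpha|=\omega\); (iii) if \(\gamma\) is a limit point of \(C_\alpha\), then \(C_\gamma=C_\alpha\cap\gamma\). For structures \(\mathcal A,\mathcal B\) with disjoint domains \(A,B\) of the same relational vocabulary, the Ehrenfeucht–Fraïssé game \(\mathcal G_{\omega_1}(\mathcal A,\mathcal B)\) is played as follows: in round \(\alpha<\omega_1\), player \(\forall\) plays \(x_\alpha\in A\cup B\), and then player \(\exists\) plays \(y_\alpha\), which has to lie in \(B\) if \(x_\alpha\in A\) and in \(A\) if \(x_\alpha\in B\). The play determines a relation \(\pi\subseteq A\times B\), and \(\exists\) wins the play if \(\pi\) is a partial isomorphism; otherwise \(\forall\) wins. The game is determined if one of the players has a winning strategy. Abelian groups are regarded as structures for the graph of addition, and \(F(\omega_1)\) is the free abelian group on \(\aleph_1\) generators. **Theorem.** Assume \(\square_{\omega_1}\). Then there is an abelian group \(G\) of cardinality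 \(\aleph_2\), all of whose subgroups of cardinality less than \(\aleph_2\) are free, such that \(\mathcal G_{\omega_1}(F(\omega_1),G)\) is not determined. Moreover, \(G\) can be taken of the following form: there are a stationary set \(E\subseteq\{\delta<\omega_2:\operatorname{cf}(\delta)=\omega\}\) which is non-reflecting (that is, \(E\cap\gamma\) is not stationary in \(\gamma\) for any limit ordinal \(\gamma<\omega_2\)) and, for each \(\delta\in E\), a strictly increasing cofinal sequence \(\eta_\delta:\omega\to\delta\), such that \(G\) is the smallest pure subgroup of \(\mathbb Z^{\omega_2}\) containing the unit vectors \(x_\alpha\) \((\alpha<\omega_2)\) and the elements \(z_\delta=\sum_{n=0}^{\infty}2^n x_{\eta_\delta(n)}\) \((\delta\in E)\). -/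

import Mathlib

open Set Order
open scoped Cardinal Ordinal

/-! ### Ehrenfeucht–Fraïssé games of transfinite length -/

namespace EFGame

universe u v w w' t

/-- `π ⊆ M × N` is a partial isomorphism between the structures `M` and `N` of the relational
vocabulary `L`: it is single-valued, injective, and it preserves every relation in both
directions. -/
def IsPartialIso (L : FirstOrder.Language.{u, v}) [L.IsRelational] {M : Type w} {N : Type w'}
    [L.Structure M] [L.Structure N] (π : Set (M × N)) : Prop :=
  (∀ p ∈ π, ∀ q ∈ π, p.1 = q.1 ↔ p.2 = q.2) ∧
  ∀ (n : ℕ) (R : L.Relations n) (a : Fin n → M) (b : Fin n → N), (∀ i, (a i, b i) ∈ π) →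
    (FirstOrder.Language.Structure.RelMap R a ↔ FirstOrder.Language.Structure.RelMap R b)

/-- A round `(x, y)`: player `∀` plays `x` and player `∃` answers with `y`; both are elements of
the (disjoint) union of the two domains. -/
abbrev Round (M : Type w) (N : Type w') : Type (max w w') := (M ⊕ N) × (M ⊕ N)

/-- The first `α` rounds of a play of length `γ`. -/
def initialPart {M : Type w} {N : Type w'} {γ : Ordinal.{t}} (p : Iio γ → Round M N)
    (α : Iio γ) : Iio (α : Ordinal.{t}) → Round M N :=
  fun β => p ⟨β, lt_trans (mem_Iio.1 β.2) (mem_Iio.1 α.2)⟩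

/-- The relation `π ⊆ M × N` determined by a play. -/
def playRel {M : Type w} {N : Type w'} {γ : Ordinal.{t}} (p : Iio γ → Round M N) : Set (M × N) :=
  {ab | ∃ α, p α = (Sum.inl ab.1, Sum.inr ab.2) ∨ p α = (Sum.inr ab.2, Sum.inl ab.1)}

/-- Player `∃` wins the play `p`: she always answered in the structure in which `∀` did not
move, and the relation determined by the play is a partial isomorphism. Otherwise `∀` wins. -/
def WonByExists (L : FirstOrder.Language.{u, v}) [L.IsRelational] {M : Type w} {N : Type w'}
    [L.Structure M] [L.Structure N] {γ : Ordinal.{t}} (p : Iio γ → Round M N) : Prop :=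
  (∀ α, (p α).1.isLeft = (p α).2.isRight) ∧ IsPartialIso L (playRel p)

/-- Player `∃` has a winning strategy in the game of length `γ`. A strategy of `∃` chooses her
`α`-th move from the rounds before `α` and the `α`-th move of `∀`. -/
def ExistsWins (L : FirstOrder.Language.{u, v}) [L.IsRelational] (γ : Ordinal.{t}) (M : Type w)
    (N : Type w') [L.Structure M] [L.Structure N] : Prop :=
  ∃ σ : (α : Iio γ) → (Iio (α : Ordinal.{t}) → Round M N) → M ⊕ N → M ⊕ N,
    ∀ p : Iio γ → Round M N, (∀ α, (p α).2 = σ α (initialPart p α) (p α).1) → WonByExists L p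

/-- Player `∀` has a winning strategy in the game of length `γ`. A strategy of `∀` chooses his
`α`-th move from the rounds before `α`. -/
def ForallWins (L : FirstOrder.Language.{u, v}) [L.IsRelational] (γ : Ordinal.{t}) (M : Type w)
    (N : Type w') [L.Structure M] [L.Structure N] : Prop :=
  ∃ τ : (α : Iio γ) → (Iio (α : Ordinal.{t}) → Round M N) → M ⊕ N,
    ∀ p : Iio γ → Round M N, (∀ α, (p α).1 = τ α (initialPart p α)) → ¬ WonByExists L p

/-- The game of length `γ` is determined: one of the players has a winning strategy. -/
def Determined (L : FirstOrder.Language.{u, v}) [L.IsRelational] (γ : Ordinal.{t}) (M : Type w)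
    (N : Type w') [L.Structure M] [L.Structure N] : Prop :=
  ExistsWins L γ M N ∨ ForallWins L γ M N

end EFGame

/-! ### Abelian groups as relational structures -/

/-- The only relation symbol: a ternary symbol for the graph of addition. -/
inductive GroupRel : ℕ → Type
  | add : GroupRel 3

/-- The relational vocabulary of (additively written) groups. -/
def groupLang : FirstOrder.Language.{0, 0} where
  Functions := fun _ => Empty
  Relations := GroupRel

instance groupLang_isRelational : groupLang.IsRelational :=
  fun _ => inferInstanceAs (IsEmpty Empty)

/-- An abelian group as a structure: the relation symbol holds of `(x, y, z)` iff `x + y = z`. -/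
instance groupStructure (A : Type*) [AddCommGroup A] : groupLang.Structure A where
  funMap := fun f => Empty.elim f
  RelMap := fun
    | GroupRel.add => fun x => x 0 + x 1 = x 2

/-- `F(κ)`, the free abelian group on `κ` generators. -/
abbrev FreeAb (κ : Ordinal.{0}) : Type 1 := FreeAbelianGroup (Iio κ)

/-- An abelian group `A` is almost free if all its subgroups of cardinality `< |A|` are free. -/
def IsAlmostFree (A : Type*) [AddCommGroup A] : Prop :=
  ∀ H : AddSubgroup A, #H < #A → Module.Free ℤ H

/-- `P` is a pure subgroup of `A`: an element of `P` divisible by `n` in `A` is divisible by `n`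
in `P`. -/
def IsPureSubgroup {A : Type*} [AddCommGroup A] (P : AddSubgroup A) : Prop :=
  ∀ (n : ℕ) (a : A), n • a ∈ P → ∃ b ∈ P, n • b = n • a

/-- The intersection of all pure subgroups containing `S`; in a torsion-free group this is the
smallest pure subgroup containing `S`. -/
def pureClosure {A : Type*} [AddCommGroup A] (S : Set A) : AddSubgroup A :=
  sInf {P | S ⊆ P ∧ IsPureSubgroup P}

theorem isPureSubgroup_pureClosure {A : Type*} [AddCommGroup A] [IsAddTorsionFree A]
    (S : Set A) : IsPureSubgroup (pureClosure S) := by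
  intro n a h
  rcases eq_or_ne n 0 with rfl | hn
  · exact ⟨0, zero_mem _, by simp⟩
  · refine ⟨a, ?_, rfl⟩
    rw [pureClosure, AddSubgroup.mem_sInf] at h ⊢
    intro P hP
    obtain ⟨b, hb, hba⟩ := hP.2 n a (h P hP)
    rwa [← nsmul_right_injective hn hba]

/-! ### Combinatorics on `ω₂` -/

/-- `γ` is a limit point of the set of ordinals `C`. -/
def IsLimitPoint (C : Set Ordinal.{0}) (γ : Ordinal.{0}) : Prop :=
  γ ≠ 0 ∧ ∀ β < γ, ∃ δ ∈ C, β < δ ∧ δ < γ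

/-- The combinatorial principle `□_{ω₁}`. -/
def SquareOmegaOne : Prop :=
  ∃ C : Ordinal.{0} → Set Ordinal.{0}, ∀ α < ω_ 2, IsSuccLimit α →
    (C α ⊆ Iio α ∧ IsClub ((↑) ⁻¹' C α : Set (Iio α))) ∧
    (α.cof = ℵ₀ → #(C α) = ℵ₀) ∧
    ∀ γ < α, IsLimitPoint (C α) γ → C γ = C α ∩ Iio γ

/-- The ordinal `ω₂`, as the set of smaller ordinals. -/
abbrev OmegaTwo : Type 1 := Iio (ω_ 2 : Ordinal.{0})

/-- `E ⊆ ω₂` is non-reflecting: `E ∩ γ` is not stationary in `γ`, for any limit `γ < ω₂`. -/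
def IsNonReflecting (E : Set OmegaTwo) : Prop :=
  ∀ γ : OmegaTwo, IsSuccLimit γ → ¬ IsStationary ((↑) ⁻¹' E : Set (Iio γ))

/-- `η` assigns to every `δ ∈ E` an ascending sequence of length `ω` cofinal in `δ`. -/
def IsLadderSystem (E : Set OmegaTwo) (η : OmegaTwo → ℕ → OmegaTwo) : Prop :=
  ∀ δ ∈ E, StrictMono (η δ) ∧ IsLUB (range (η δ)) δ

/-! ### The group -/

open Classical in
/-- The unit vector `x_α` of `ℤ^{ω₂}`. -/
noncomputable def unitVector (α : OmegaTwo) : OmegaTwo → ℤ := Pi.single α 1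

/-- The element `∑ₙ 2ⁿ x_{e(n)}` of `ℤ^{ω₂}`, computed coordinatewise (every coordinate is a
finite sum when `e` is injective). -/
noncomputable def ladderVector (e : ℕ → OmegaTwo) : OmegaTwo → ℤ :=
  fun i => ∑ᶠ n : ℕ, 2 ^ n * unitVector (e n) i

/-- The smallest pure subgroup of `ℤ^{ω₂}` containing all `x_α`, `α < ω₂`, and all
`z_δ = ∑ₙ 2ⁿ x_{η_δ(n)}`, `δ ∈ E`. -/
noncomputable def ladderGroup (E : Set OmegaTwo) (η : OmegaTwo → ℕ → OmegaTwo) :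
    AddSubgroup (OmegaTwo → ℤ) :=
  pureClosure (range unitVector ∪ (fun δ => ladderVector (η δ)) '' E)

/-!
Let `C` be a square sequence. The relation "`γ` is a limit point of `C δ`" is a tree order. Points
of cofinality `ω` have countable heights in this tree, so by the completeness of the club filter
some level `E`, restricted to fixed points of `γ ↦ ω₁ γ` of cofinality `ω`, is stationary. A level
is non-reflecting: the limit points of `C γ` form a chain, so they meet `E` at most once. Choose
any ladder system `η` on `E`, and let `G` be the ladder group.

`G` is filtered by the groups `G_α` generated by the `x_β`, `β < α`, and by the tails of the `z_δ`,
`δ ∈ E ∩ α`. Since `E` does not reflect, the ladders between `β ∉ E` and `α` can be made disjoint by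
removing finite initial segments (`exists_isDisjointing`). The disjoint tails and the remaining unit
vectors then form a unitriangular family that generates `G_α` over `G_β`
(`exists_isUnitriangular_generators`). With `β = 0` this shows that all `G_α`, `α < ω₂`, are free,
that `G` is the union of the `G_α`, and that `G` is almost free.

`∃` has no winning strategy (`not_existsWins`). By stationarity some `δ ∈ E` is closed under a given
strategy. Then `∀` can force a partial isomorphism that maps a countable part of `G_δ` containing the
`x_{η_δ(n)}` into a free factor of `F(ω₁)`, and back. Afterwards he plays the tails of `z_δ`. The
image of `z_δ` would be divisible by all powers of `2` modulo the free factor without lying in it.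

`∀` has no winning strategy (`IsSquareSequence.not_forallWins`). The filtration is now followed along
the branches of the tree. Above level `E` a branch of `δ` is closed and avoids `E`, so between two
consecutive points of it the group has a unitriangular family as above. These families, matched
once and for all with levels of generators of `F(ω₁)`, fit together to partial isomorphisms
`π_δ` with `G_{ω₁ δ}`, and `π_γ ⊆ π_δ` whenever `γ` is on the branch of `δ`: the choice depends only
on pairs of consecutive points, and by coherence of `C` the branch of `γ` is an initial segment of
that of `δ`. So there are few partial isomorphisms to consider: one for each `γ < ω₂`. Given a
strategy of `∀`, closing off yields `δ` of cofinality `ω₁` such that the moves of `∀` against each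
`π_γ`, `γ < δ`, lie in the field of `π_δ`; and `∃` wins by following `π_δ`, since each countable
part of the play already follows some `π_γ` with `γ` on the branch of `δ`
(`EFGame.not_forallWins_of_countably_directed`).
-/

/-! ### Ladder vectors and unitriangular families -/

/-- The `n`-th tail `∑ₘ 2ᵐ x_{e(n+m)}` of the ladder vector of `e`. -/
noncomputable def tailVector (e : ℕ → OmegaTwo) (n : ℕ) : OmegaTwo → ℤ :=
  ladderVector fun m => e (n + m)

theorem unitVector_self (α : OmegaTwo) : unitVector α α = 1 := by
  simp [unitVector]

theorem unitVector_of_ne {α i : OmegaTwo} (h : i ≠ α) : unitVector α i = 0 := by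
  simp [unitVector, h]

theorem tailVector_zero (e : ℕ → OmegaTwo) : tailVector e 0 = ladderVector e := by
  simp [tailVector]

theorem ladderVector_apply_self {e : ℕ → OmegaTwo} (he : Function.Injective e) (k : ℕ) :
    ladderVector e (e k) = 2 ^ k := by
  rw [ladderVector, finsum_eq_single _ k]
  · simp [unitVector_self]
  · intro n hn
    rw [unitVector_of_ne (fun h => hn (he h).symm), mul_zero]

theorem ladderVector_apply_of_notMem {e : ℕ → OmegaTwo} {i : OmegaTwo} (hi : i ∉ range e) :
    ladderVector e i = 0 := by
  rw [ladderVector]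
  apply finsum_eq_zero_of_forall_eq_zero
  intro n
  rw [unitVector_of_ne (fun h => hi ⟨n, h.symm⟩), mul_zero]

theorem tailVector_apply_of_lt {e : ℕ → OmegaTwo} (he : StrictMono e) {n : ℕ} {i : OmegaTwo}
    (hi : i < e n) : tailVector e n i = 0 := by
  apply ladderVector_apply_of_notMem
  rintro ⟨m, rfl⟩
  exact absurd (he.monotone (Nat.le_add_right n m)) (not_le.2 hi)

theorem tailVector_apply_self {e : ℕ → OmegaTwo} (he : StrictMono e) (n : ℕ) :
    tailVector e n (e n) = 1 := by
  have := ladderVector_apply_self (e := fun m => e (n + m))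
    (fun a b h => by simpa using he.injective h) 0
  simpa [tailVector] using this

theorem tailVector_apply_of_forall_ne {e : ℕ → OmegaTwo} (n : ℕ) {i : OmegaTwo}
    (hi : ∀ m, e m ≠ i) : tailVector e n i = 0 := by
  apply ladderVector_apply_of_notMem
  rintro ⟨m, rfl⟩
  exact hi _ rfl

theorem tailVector_eq {e : ℕ → OmegaTwo} (he : StrictMono e) (n : ℕ) :
    tailVector e n = unitVector (e n) + (2 : ℤ) • tailVector e (n + 1) := by
  have inj : ∀ n, Function.Injective fun m => e (n + m) :=
    fun n a b h => by simpa using he.injective h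
  funext i
  by_cases hi : i ∈ range e
  · obtain ⟨k, rfl⟩ := hi
    rcases lt_trichotomy k n with h | rfl | h
    · have h' : e k ≠ e n := he.injective.ne h.ne
      simp [tailVector_apply_of_lt he (he h), tailVector_apply_of_lt he (he (h.trans n.lt_succ_self)),
        unitVector_of_ne h']
    · simp [tailVector_apply_self he, unitVector_self, tailVector_apply_of_lt he (he k.lt_succ_self)]
    · obtain ⟨m, rfl⟩ : ∃ m, k = n + 1 + m := ⟨k - (n + 1), by omega⟩
      have h' : e (n + 1 + m) ≠ e n := he.injective.ne h.ne'
      have h1 := ladderVector_apply_self (inj n) (1 + m)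
      have h2 := ladderVector_apply_self (inj (n + 1)) m
      simp only [← add_assoc] at h1
      simp only [tailVector, Pi.add_apply, Pi.smul_apply, h1, h2, unitVector_of_ne h', smul_eq_mul]
      ring
  · have h' : ∀ m, e m ≠ i := fun m h => hi ⟨m, h⟩
    simp [tailVector_apply_of_forall_ne _ h', unitVector_of_ne (h' n).symm]

/-- A family of vectors `y ν` is unitriangular on `s` if for `ν ∈ s` the first nonzero coordinate
of `y ν` is a `1` at `ν`. -/
def IsUnitriangular (y : OmegaTwo → OmegaTwo → ℤ) (s : Set OmegaTwo) : Prop :=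
  ∀ ν ∈ s, y ν ν = 1 ∧ ∀ i < ν, y ν i = 0

/-- If an integral combination of a unitriangular family is divisible by `p` at all coordinates
in `s`, then so are all coefficients: look at the least coefficient not divisible by `p`. With
`p = 0` this is linear independence. -/
theorem IsUnitriangular.dvd_coeff {y : OmegaTwo → OmegaTwo → ℤ} {s : Set OmegaTwo}
    (hy : IsUnitriangular y s) (c : OmegaTwo →₀ ℤ) (hc : ∀ ν ∈ c.support, ν ∈ s) (p : ℤ)
    (h : ∀ i ∈ s, p ∣ (c.sum fun ν a => a • y ν) i) (ν : OmegaTwo) : p ∣ c ν := by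
  by_contra hν
  obtain ⟨μ, hμ, hmin⟩ := WellFounded.has_min (wellFounded_lt (α := OmegaTwo))
    {μ | ¬ p ∣ c μ} ⟨ν, hν⟩
  have hμ0 : μ ∈ c.support := by
    rw [Finsupp.mem_support_iff]
    intro h0
    exact hμ (by simp [h0])
  have hμs := hc μ hμ0
  have key := h μ hμs
  rw [Finsupp.sum, Finset.sum_apply, ← Finset.add_sum_erase _ _ hμ0] at key
  apply hμ
  have h2 : p ∣ ∑ x ∈ c.support.erase μ, (c x • y x) μ := by
    apply Finset.dvd_sum
    intro x hx
    rw [Finset.mem_erase] at hx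
    rw [Pi.smul_apply, smul_eq_mul]
    rcases lt_or_gt_of_ne hx.1 with hlt | hlt
    · have : p ∣ c x := by
        by_contra hx'
        exact hmin x hx' hlt
      exact Dvd.dvd.mul_right this _
    · rw [(hy x (hc x hx.2)).2 μ hlt, mul_zero]
      exact dvd_zero _
  have h3 := (dvd_add_left h2).1 key
  simpa [(hy μ hμs).1] using h3

/-! ### The filtration of the group -/

/-- The subgroup generated by the unit vectors `x_β`, `β < α`, and all tails of the ladder vectors
`z_δ`, `δ ∈ E`, `δ < α`. These groups filter the ladder group. -/
noncomputable def filtrationGroup (E : Set OmegaTwo) (η : OmegaTwo → ℕ → OmegaTwo)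
    (α : Ordinal.{0}) : Submodule ℤ (OmegaTwo → ℤ) :=
  Submodule.span ℤ ({v | ∃ β : OmegaTwo, β.1 < α ∧ v = unitVector β} ∪
    {v | ∃ δ ∈ E, δ.1 < α ∧ ∃ n, v = tailVector (η δ) n})

section Filtration

variable {E : Set OmegaTwo} {η : OmegaTwo → ℕ → OmegaTwo}

theorem unitVector_mem_filtrationGroup {β : OmegaTwo} {α : Ordinal.{0}} (h : β.1 < α) :
    unitVector β ∈ filtrationGroup E η α :=
  Submodule.subset_span (Or.inl ⟨β, h, rfl⟩)

theorem tailVector_mem_filtrationGroup {δ : OmegaTwo} (hδ : δ ∈ E) {α : Ordinal.{0}}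
    (h : δ.1 < α) (n : ℕ) : tailVector (η δ) n ∈ filtrationGroup E η α :=
  Submodule.subset_span (Or.inr ⟨δ, hδ, h, n, rfl⟩)

theorem filtrationGroup_mono {α β : Ordinal.{0}} (h : α ≤ β) :
    filtrationGroup E η α ≤ filtrationGroup E η β := by
  apply Submodule.span_le.2
  rintro v (⟨γ, hγ, rfl⟩ | ⟨δ, hδ, hδα, n, rfl⟩)
  · exact unitVector_mem_filtrationGroup (hγ.trans_le h)
  · exact tailVector_mem_filtrationGroup hδ (hδα.trans_le h) n

/-- The filtration is continuous: every element already appears below a given limit stage. -/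
theorem exists_lt_mem_filtrationGroup {α : Ordinal.{0}} (hα : IsSuccLimit α)
    {v : OmegaTwo → ℤ} (hv : v ∈ filtrationGroup E η α) :
    ∃ β < α, v ∈ filtrationGroup E η β := by
  induction hv using Submodule.span_induction with
  | mem v hv =>
    rcases hv with ⟨γ, hγ, rfl⟩ | ⟨δ, hδ, hδα, n, rfl⟩
    · exact ⟨_, hα.succ_lt hγ, unitVector_mem_filtrationGroup (lt_succ _)⟩
    · exact ⟨_, hα.succ_lt hδα, tailVector_mem_filtrationGroup hδ (lt_succ _) n⟩
  | zero => exact ⟨0, hα.bot_lt, zero_mem _⟩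
  | add u v _ _ hu hv =>
    obtain ⟨β, hβ, hu⟩ := hu
    obtain ⟨γ, hγ, hv⟩ := hv
    exact ⟨max β γ, max_lt hβ hγ, add_mem (filtrationGroup_mono (le_max_left _ _) hu)
      (filtrationGroup_mono (le_max_right _ _) hv)⟩
  | smul a v _ hv =>
    obtain ⟨β, hβ, hv⟩ := hv
    exact ⟨β, hβ, Submodule.smul_mem _ _ hv⟩

theorem IsLadderSystem.lt (h : IsLadderSystem E η) {δ : OmegaTwo} (hδ : δ ∈ E) (n : ℕ) :
    η δ n < δ :=
  ((h δ hδ).1 n.lt_succ_self).trans_le ((h δ hδ).2.1 ⟨_, rfl⟩)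

theorem IsLadderSystem.exists_gt (h : IsLadderSystem E η) {δ : OmegaTwo} (hδ : δ ∈ E)
    {β : OmegaTwo} (hβ : β < δ) : ∃ n, β < η δ n := by
  obtain ⟨_, ⟨n, rfl⟩, hn⟩ := (lt_isLUB_iff (h δ hδ).2).1 hβ
  exact ⟨n, hn⟩

/-- Elements of the stage `α` of the filtration are supported below `α`. -/
theorem apply_eq_zero_of_mem_filtrationGroup (h : IsLadderSystem E η) {α : Ordinal.{0}}
    {v : OmegaTwo → ℤ} (hv : v ∈ filtrationGroup E η α) {i : OmegaTwo} (hi : α ≤ i.1) :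
    v i = 0 := by
  induction hv using Submodule.span_induction with
  | mem v hv =>
    rcases hv with ⟨γ, hγ, rfl⟩ | ⟨δ, hδ, hδα, n, rfl⟩
    · refine unitVector_of_ne ?_
      rintro rfl
      exact absurd hγ (not_lt.2 hi)
    · apply tailVector_apply_of_forall_ne
      rintro m rfl
      exact absurd ((Subtype.coe_lt_coe.2 (h.lt hδ m)).trans hδα) (not_lt.2 hi)
  | zero => rfl
  | add u v _ _ hu hv => rw [Pi.add_apply, hu, hv, add_zero]
  | smul a v _ hv => rw [Pi.smul_apply, hv, smul_zero]

theorem ladderVector_notMem_filtrationGroup (h : IsLadderSystem E η) {δ : OmegaTwo} (hδ : δ ∈ E)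
    (hlim : IsSuccLimit δ.1) : ladderVector (η δ) ∉ filtrationGroup E η δ.1 := by
  intro hmem
  obtain ⟨β, hβ, hv⟩ := exists_lt_mem_filtrationGroup hlim hmem
  obtain ⟨n, hn⟩ := h.exists_gt hδ (β := ⟨β, hβ.trans δ.2⟩) hβ
  have := apply_eq_zero_of_mem_filtrationGroup h hv (i := η δ n) (le_of_lt hn)
  rw [ladderVector_apply_self (h δ hδ).1.injective] at this
  exact absurd this (by positivity)

end Filtration

/-! ### Disjoint tails of the ladders and bases of the quotients -/

section Tails

variable {E : Set OmegaTwo} {η : OmegaTwo → ℕ → OmegaTwo}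

theorem exists_isLUB_omegaTwo {T : Set OmegaTwo} (hT : BddAbove T) : ∃ ℓ, IsLUB T ℓ := by
  obtain ⟨m, hm, hmin⟩ := WellFounded.has_min (wellFounded_lt (α := OmegaTwo)) (upperBounds T) hT
  exact ⟨m, hm, fun x hx => not_lt.1 (hmin x hx)⟩

/-- A start `n δ` of a tail of the ladder at each `δ ∈ E` between `β` and `α`, such that the tails
lie above `β` and are pairwise disjoint. -/
def IsDisjointing (E : Set OmegaTwo) (η : OmegaTwo → ℕ → OmegaTwo) (β α : OmegaTwo)
    (n : OmegaTwo → ℕ) : Prop :=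
  (∀ δ ∈ E, β < δ → δ < α → β ≤ η δ (n δ)) ∧
  ∀ δ ∈ E, ∀ δ' ∈ E, β < δ → δ < δ' → δ' < α →
    ∀ m ≥ n δ, ∀ m' ≥ n δ', η δ m ≠ η δ' m'

/-- At a limit stage `α`, a club of `α` that misses `E` cuts `α` into blocks. Tails that are
disjoint within each block and lie above its lower end are disjoint altogether. -/
theorem exists_isDisjointing_of_isSuccLimit (h : IsLadderSystem E η) {α : OmegaTwo}
    (hns : ¬ IsStationary ((↑) ⁻¹' E : Set (Iio α)))
    (ih : ∀ γ < α, ∀ β ≤ γ, β ∉ E → ∃ n, IsDisjointing E η β γ n) {β : OmegaTwo} (hβ : β ∉ E) :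
    ∃ n, IsDisjointing E η β α n := by
  obtain ⟨D, hD, hdisj⟩ := not_isStationary_iff.1 hns
  have hDE : ∀ d : Iio α, d ∈ D → d.1 ∉ E := fun d hd hE =>
    Set.disjoint_left.1 hdisj hE hd
  let T : OmegaTwo → Set OmegaTwo := fun δ => insert β {x | x < δ ∧ ∃ hx : x < α, ⟨x, hx⟩ ∈ D}
  -- the lower end of the block of `δ`
  have hlo : ∀ δ : OmegaTwo, ∃ ℓ, δ ∈ E → β < δ → δ < α → IsLUB (T δ) ℓ ∧ ℓ < δ ∧ ℓ ∉ E := by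
    intro δ
    by_cases hδ : δ ∈ E ∧ β < δ ∧ δ < α
    swap
    · exact ⟨β, fun h1 h2 h3 => absurd ⟨h1, h2, h3⟩ hδ⟩
    obtain ⟨hδE, hβδ, hδα⟩ := hδ
    have hub : δ ∈ upperBounds (T δ) := by
      rintro x (rfl | hx)
      · exact hβδ.le
      · exact hx.1.le
    obtain ⟨ℓ, hℓ⟩ := exists_isLUB_omegaTwo ⟨δ, hub⟩
    have hℓδ : ℓ ≤ δ := hℓ.2 hub
    have hℓα : ℓ < α := hℓδ.trans_lt hδα
    have hβℓ : β ≤ ℓ := hℓ.1 (mem_insert _ _)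
    have hcase : ℓ = β ∨ ⟨ℓ, hℓα⟩ ∈ D := by
      by_contra! hcon
      have hβlt : β < ℓ := lt_of_le_of_ne hβℓ (Ne.symm hcon.1)
      obtain ⟨x, hx, hβx⟩ := (lt_isLUB_iff hℓ).1 hβlt
      have hxD : x < δ ∧ ∃ hx : x < α, ⟨x, hx⟩ ∈ D := by
        rcases hx with rfl | hx
        · exact absurd hβx (lt_irrefl _)
        · exact hx
      apply hcon.2
      refine hD.isLUB_mem (t := {d | d ∈ D ∧ d.1 < δ}) (fun d hd => hd.1)
        ⟨⟨x, hxD.2.1⟩, hxD.2.2, hxD.1⟩ ⟨?_, ?_⟩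
      · intro d hd
        exact hℓ.1 (Or.inr ⟨hd.2, d.2, hd.1⟩)
      · intro u hu
        refine hℓ.2 ?_
        rintro z (rfl | ⟨hz1, hz2, hz3⟩)
        · exact hβx.le.trans (hu (a := ⟨x, hxD.2.1⟩) ⟨hxD.2.2, hxD.1⟩)
        · exact hu (a := ⟨z, hz2⟩) ⟨hz3, hz1⟩
    have hℓE : ℓ ∉ E := by
      rcases hcase with rfl | hcase
      · exact hβ
      · exact hDE _ hcase
    refine ⟨ℓ, fun _ _ _ => ⟨hℓ, lt_of_le_of_ne hℓδ ?_, hℓE⟩⟩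
    rintro rfl
    exact hℓE hδE
  choose lo hlo using hlo
  -- the upper end of the block of `δ`
  have hhi : ∀ δ : OmegaTwo, ∃ u, δ ∈ E → δ < α → δ < u ∧ ∃ hu : u < α, ⟨u, hu⟩ ∈ D := by
    intro δ
    by_cases hδ : δ ∈ E ∧ δ < α
    · obtain ⟨u, huD, hu⟩ := hD.isCofinal ⟨δ, hδ.2⟩
      refine ⟨u.1, fun _ _ => ⟨lt_of_le_of_ne hu ?_, u.2, huD⟩⟩
      rintro rfl
      exact hDE u huD hδ.1
    · exact ⟨β, fun h1 h2 => absurd ⟨h1, h2⟩ hδ⟩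
  have hhi' : ∀ δ : OmegaTwo, ∃ u, δ ∈ E → δ < α →
      (δ < u ∧ ∃ hu : u < α, ⟨u, hu⟩ ∈ D) ∧
      ∀ x, δ < x → (∃ hx : x < α, ⟨x, hx⟩ ∈ D) → u ≤ x := by
    intro δ
    by_cases hδ : δ ∈ E ∧ δ < α
    · obtain ⟨u, hu⟩ := hhi δ
      obtain ⟨m, hm, hmin⟩ := WellFounded.has_min (wellFounded_lt (α := OmegaTwo))
        {u : OmegaTwo | δ < u ∧ ∃ hu : u < α, (⟨u, hu⟩ : Iio α) ∈ D} ⟨u, hu hδ.1 hδ.2⟩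
      exact ⟨m, fun _ _ => ⟨hm, fun x hx hxD => not_lt.1 (hmin x ⟨hx, hxD⟩)⟩⟩
    · exact ⟨β, fun h1 h2 => absurd ⟨h1, h2⟩ hδ⟩
  choose hi hhi using hhi'
  have hN : ∀ b γ : OmegaTwo, ∃ n, γ < α → b ≤ γ → b ∉ E → IsDisjointing E η b γ n := by
    intro b γ
    by_cases hc : γ < α ∧ b ≤ γ ∧ b ∉ E
    · obtain ⟨n, hn⟩ := ih γ hc.1 b hc.2.1 hc.2.2
      exact ⟨n, fun _ _ _ => hn⟩
    · exact ⟨0, fun h1 h2 h3 => absurd ⟨h1, h2, h3⟩ hc⟩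
  choose N hN using hN
  have key : ∀ δ ∈ E, β < δ → δ < α → IsDisjointing E η (lo δ) (hi δ) (N (lo δ) (hi δ)) := by
    intro δ hδ h1 h2
    obtain ⟨⟨h3, h4, -⟩, -⟩ := hhi δ hδ h2
    obtain ⟨-, h5, h6⟩ := hlo δ hδ h1 h2
    exact hN _ _ h4 (h5.trans h3).le h6
  refine ⟨fun δ => N (lo δ) (hi δ) δ, fun δ hδ h1 h2 => ?_, ?_⟩
  · obtain ⟨hl1, hl2, -⟩ := hlo δ hδ h1 h2
    exact (hl1.1 (mem_insert _ _)).trans ((key δ hδ h1 h2).1 δ hδ hl2 (hhi δ hδ h2).1.1)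
  · intro δ hδ δ' hδ' h1 hlt h2 m hm m' hm'
    have h1' := h1.trans hlt
    have h2' := hlt.trans h2
    obtain ⟨hl1, hl2, -⟩ := hlo δ hδ h1 h2'
    obtain ⟨hl1', hl2', -⟩ := hlo δ' hδ' h1' h2
    obtain ⟨⟨hu1, hu2, hu3⟩, hu4⟩ := hhi δ hδ h2'
    obtain ⟨⟨hu1', hu2', hu3'⟩, hu4'⟩ := hhi δ' hδ' h2
    rcases le_or_gt (hi δ) δ' with hc | hc
    · -- different blocks
      have hne : hi δ ≠ δ' := by
        intro he
        exact hDE _ hu3 (he ▸ hδ')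
      have h3 : hi δ ≤ lo δ' := hl1'.1 (Or.inr ⟨lt_of_le_of_ne hc hne, hu2, hu3⟩)
      have h4 : lo δ' ≤ η δ' m' := ((key δ' hδ' h1' h2).1 δ' hδ' hl2' hu1').trans
        ((h δ' hδ').1.monotone hm')
      exact ((h.lt hδ m).trans_le (hu1.le.trans (h3.trans h4))).ne
    · -- the same block
      have hTT : T δ = T δ' := by
        ext x
        constructor
        · rintro (rfl | ⟨hx1, hx2⟩)
          · exact mem_insert _ _
          · exact Or.inr ⟨hx1.trans hlt, hx2⟩
        · rintro (rfl | ⟨hx1, hx2⟩)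
          · exact mem_insert _ _
          · refine Or.inr ⟨?_, hx2⟩
            rcases lt_trichotomy x δ with hx | rfl | hx
            · exact hx
            · exact absurd hδ (hDE _ hx2.2)
            · exact absurd (hu4 x hx hx2) (not_le.2 (hx1.trans hc))
      have hloe : lo δ' = lo δ := by
        rw [hTT] at hl1
        exact hl1'.unique hl1
      have hhie : hi δ' = hi δ :=
        le_antisymm (hu4' _ hc ⟨hu2, hu3⟩) (hu4 _ (hlt.trans hu1') ⟨hu2', hu3'⟩)
      simp only [hloe, hhie] at hm'
      exact (key δ hδ h1 h2').2 δ hδ δ' hδ' hl2 hlt hc m hm m' hm'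

/-- At a successor stage a single ladder is added; it meets each earlier ladder in a finite set,
because `η γ` has order type `ω` and is cofinal in `γ`. -/
theorem exists_isDisjointing_of_covBy (h : IsLadderSystem E η) {γ α β : OmegaTwo}
    (hγ : γ ⋖ α) {n : OmegaTwo → ℕ} (hn : IsDisjointing E η β γ n) :
    ∃ n, IsDisjointing E η β α n := by
  have hle : ∀ δ, δ < α → δ ≤ γ := fun δ hδ => hγ.le_of_lt hδ
  by_cases hγE : γ ∈ E ∧ β < γ
  swap
  · refine ⟨n, fun δ hδ h1 h2 => ?_, fun δ hδ δ' hδ' h1 h2 h3 => ?_⟩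
    · rcases (hle δ h2).eq_or_lt with rfl | h4
      · exact absurd ⟨hδ, h1⟩ hγE
      · exact hn.1 δ hδ h1 h4
    · rcases (hle δ' h3).eq_or_lt with rfl | h4
      · exact absurd ⟨hδ', h1.trans h2⟩ hγE
      · exact hn.2 δ hδ δ' hδ' h1 h2 h4
  obtain ⟨hγE, hβγ⟩ := hγE
  obtain ⟨k, hk⟩ := h.exists_gt hγE hβγ
  have hb : ∀ δ, ∃ b, δ ∈ E → δ < γ → ∀ j, η γ j < δ → η γ j < η δ b := by
    intro δ
    by_cases hδ : δ ∈ E ∧ δ < γ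
    swap
    · exact ⟨0, fun h1 h2 => absurd ⟨h1, h2⟩ hδ⟩
    obtain ⟨hδE, hδγ⟩ := hδ
    obtain ⟨K, hK⟩ := h.exists_gt hγE hδγ
    have : ∀ j, ∃ b, η γ j < δ → η γ j < η δ b := by
      intro j
      by_cases hj : η γ j < δ
      · obtain ⟨b, hb⟩ := h.exists_gt hδE hj
        exact ⟨b, fun _ => hb⟩
      · exact ⟨0, fun h => absurd h hj⟩
    choose f hf using this
    refine ⟨(Finset.range K).sup f, fun _ _ j hj => (hf j hj).trans_le ?_⟩
    apply (h δ hδE).1.monotone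
    apply Finset.le_sup (f := f)
    rw [Finset.mem_range]
    exact (h γ hγE).1.lt_iff_lt.1 (hj.trans hK)
  choose b hb using hb
  classical
  refine ⟨fun δ => if δ = γ then k else max (n δ) (b δ), fun δ hδ h1 h2 => ?_,
    fun δ hδ δ' hδ' h1 h2 h3 m hm m' hm' => ?_⟩
  · by_cases hδγ : δ = γ
    · subst hδγ
      simpa using hk.le
    · simp only [hδγ, if_false]
      exact (hn.1 δ hδ h1 (lt_of_le_of_ne (hle δ h2) hδγ)).trans
        ((h δ hδ).1.monotone (le_max_left _ _))
  · have hδγ : δ < γ := h2.trans_le (hle δ' h3)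
    simp only [hδγ.ne, if_false] at hm
    by_cases hδ'γ : δ' = γ
    · subst hδ'γ
      intro he
      have h4 := hb δ hδ hδγ m' (he ▸ h.lt hδ m)
      rw [← he] at h4
      exact absurd ((h δ hδ).1.lt_iff_lt.1 h4) (not_lt.2 ((le_max_right _ _).trans hm))
    · simp only [hδ'γ, if_false] at hm'
      exact hn.2 δ hδ δ' hδ' h1 h2 (lt_of_le_of_ne (hle δ' h3) hδ'γ) m ((le_max_left _ _).trans hm)
        m' ((le_max_left _ _).trans hm')

theorem exists_isDisjointing (h : IsLadderSystem E η) (hE : IsNonReflecting E) (α : OmegaTwo) :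
    ∀ β ≤ α, β ∉ E → ∃ n, IsDisjointing E η β α n := by
  induction α using WellFoundedLT.induction with
  | ind α ih =>
  intro β hβα hβ
  by_cases hmin : IsMin α
  · exact ⟨0, fun δ _ _ h2 => absurd h2 hmin.not_lt,
      fun _ _ δ' _ _ _ h3 => absurd h3 hmin.not_lt⟩
  by_cases hpre : IsSuccPrelimit α
  · exact exists_isDisjointing_of_isSuccLimit h (hE α ⟨hmin, hpre⟩) ih hβ
  · obtain ⟨γ, hγ⟩ := not_isSuccPrelimit_iff.1 hpre
    rcases hβα.eq_or_lt with rfl | hlt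
    · exact ⟨0, fun δ _ h1 h2 => absurd h2 h1.not_gt,
        fun _ _ δ' _ h1 h2 h3 => absurd h3 (h1.trans h2).not_gt⟩
    · obtain ⟨n, hn⟩ := ih γ hγ.lt β (hγ.le_of_lt hlt) hβ
      exact exists_isDisjointing_of_covBy h hγ hn

/-- If `β ∉ E`, the stage `α` of the filtration is generated over the stage `β` by a family that is
unitriangular on `[β, α)`; in particular the quotient is free. The family consists of the disjoint
tails, placed at their first coordinates, and of the unit vectors at the remaining places. -/
theorem exists_isUnitriangular_generators (h : IsLadderSystem E η) (hE : IsNonReflecting E)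
    {β α : OmegaTwo} (hβα : β ≤ α) (hβ : β ∉ E) :
    ∃ y : OmegaTwo → OmegaTwo → ℤ, IsUnitriangular y univ ∧
      (∀ ν < α, y ν ∈ filtrationGroup E η α) ∧
      filtrationGroup E η α ≤ filtrationGroup E η β ⊔ Submodule.span ℤ (y '' Ico β α) := by
  classical
  obtain ⟨n, hn1, hn2⟩ := exists_isDisjointing h hE α β hβα hβ
  -- `P ν δ m`: the place `ν` is the `m`-th place of the chosen tail of the ladder at `δ`
  let P : OmegaTwo → OmegaTwo → ℕ → Prop := fun ν δ m =>
    δ ∈ E ∧ β < δ ∧ δ < α ∧ n δ ≤ m ∧ η δ m = ν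
  have hP : ∀ ν δ m δ' m', P ν δ m → P ν δ' m' → δ = δ' ∧ m = m' := by
    rintro ν δ m δ' m' ⟨h1, h2, h3, h4, h5⟩ ⟨h1', h2', h3', h4', h5'⟩
    rcases lt_trichotomy δ δ' with hlt | rfl | hlt
    · exact absurd (h5.trans h5'.symm) (hn2 δ h1 δ' h1' h2 hlt h3' m h4 m' h4')
    · exact ⟨rfl, (h δ h1).1.injective (h5.trans h5'.symm)⟩
    · exact absurd (h5'.trans h5.symm) (hn2 δ' h1' δ h1 h2' hlt h3 m' h4' m h4)
  have hy : ∀ ν, ∃ v : OmegaTwo → ℤ, (∀ δ m, P ν δ m → v = tailVector (η δ) m) ∧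
      ((¬ ∃ δ m, P ν δ m) → v = unitVector ν) := by
    intro ν
    by_cases hν : ∃ δ m, P ν δ m
    · obtain ⟨δ, m, hδm⟩ := hν
      refine ⟨tailVector (η δ) m, fun δ' m' h' => ?_, fun hc => absurd ⟨δ, m, hδm⟩ hc⟩
      obtain ⟨rfl, rfl⟩ := hP ν δ m δ' m' hδm h'
      rfl
    · exact ⟨unitVector ν, fun δ m hδm => absurd ⟨δ, m, hδm⟩ hν, fun _ => rfl⟩
  choose y hy1 hy2 using hy
  refine ⟨y, ?_, ?_, ?_⟩
  · intro ν _
    by_cases hν : ∃ δ m, P ν δ m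
    · obtain ⟨δ, m, hδm⟩ := hν
      rw [hy1 ν δ m hδm]
      obtain ⟨h1, h2, h3, h4, rfl⟩ := hδm
      exact ⟨tailVector_apply_self (h δ h1).1 m, fun i hi => tailVector_apply_of_lt (h δ h1).1 hi⟩
    · rw [hy2 ν hν]
      exact ⟨unitVector_self ν, fun i hi => unitVector_of_ne hi.ne⟩
  · intro ν hν
    by_cases hν : ∃ δ m, P ν δ m
    · obtain ⟨δ, m, hδm⟩ := hν
      rw [hy1 ν δ m hδm]
      exact tailVector_mem_filtrationGroup hδm.1 hδm.2.2.1 m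
    · rw [hy2 ν hν]
      exact unitVector_mem_filtrationGroup ‹_›
  · set Q := filtrationGroup E η β ⊔ Submodule.span ℤ (y '' Ico β α) with hQ
    have hyQ : ∀ ν, β ≤ ν → ν < α → y ν ∈ Q := fun ν h1 h2 =>
      Submodule.mem_sup_right (Submodule.subset_span ⟨ν, ⟨h1, h2⟩, rfl⟩)
    have htail : ∀ δ ∈ E, β < δ → δ < α → ∀ m, n δ ≤ m → tailVector (η δ) m ∈ Q := by
      intro δ hδ h1 h2 m hm
      rw [← hy1 (η δ m) δ m ⟨hδ, h1, h2, hm, rfl⟩]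
      exact hyQ _ ((hn1 δ hδ h1 h2).trans ((h δ hδ).1.monotone hm)) ((h.lt hδ m).trans h2)
    have hunit : ∀ ν < α, unitVector ν ∈ Q := by
      intro ν hν
      rcases lt_or_ge ν β with hνβ | hνβ
      · exact Submodule.mem_sup_left (unitVector_mem_filtrationGroup hνβ)
      by_cases hc : ∃ δ m, P ν δ m
      · obtain ⟨δ, m, h1, h2, h3, h4, rfl⟩ := hc
        rw [eq_sub_of_add_eq (tailVector_eq (h δ h1).1 m).symm]
        exact sub_mem (htail δ h1 h2 h3 m h4)
          (Submodule.smul_mem _ _ (htail δ h1 h2 h3 (m + 1) (h4.trans m.le_succ)))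
      · rw [← hy2 ν hc]
        exact hyQ ν hνβ hν
    apply Submodule.span_le.2
    rintro v (⟨γ, hγ, rfl⟩ | ⟨δ, hδ, hδα, m, rfl⟩)
    · exact hunit γ hγ
    · rcases lt_trichotomy δ β with hlt | rfl | hlt
      · exact Submodule.mem_sup_left (tailVector_mem_filtrationGroup hδ hlt m)
      · exact absurd hδ hβ
      · -- a longer tail differs from a shorter one by unit vectors
        have hdown : ∀ k m, n δ ≤ m + k → tailVector (η δ) m ∈ Q := by
          intro k
          induction k with
          | zero => exact fun m hm => htail δ hδ hlt hδα m hm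
          | succ k ihk =>
            intro m hm
            rw [tailVector_eq (h δ hδ).1 m]
            exact add_mem (hunit _ ((h.lt hδ m).trans hδα))
              (Submodule.smul_mem _ _ (ihk (m + 1) (by omega)))
        exact hdown (n δ) m (Nat.le_add_left _ _)

end Tails

/-! ### Cardinalities below `ω₂` -/

theorem mk_omegaTwo : #OmegaTwo = ℵ_ 2 := by
  simp [OmegaTwo]

theorem cof_omegaTwo : Order.cof OmegaTwo = ℵ_ 2 := by
  have h := Cardinal.cof_omega_add_one 1
  rw [one_add_one_eq_two] at h
  have h' : Order.cof (Iio (ω_ 2 : Ordinal.{0})) = ℵ_ 2 := by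
    rw [Ordinal.cof_Iio, ← Ordinal.lift_cof, h]
    simp
  exact h'

theorem aleph_one_lt_aleph_two : (ℵ_ 1 : Cardinal.{1}) < ℵ_ 2 :=
  Cardinal.aleph_lt_aleph.2 one_lt_two

theorem cof_omegaTwo_ne_aleph0 : Order.cof OmegaTwo ≠ ℵ₀ := by
  rw [cof_omegaTwo]
  exact (Cardinal.aleph0_lt_aleph.2 two_pos).ne'

theorem mk_Iio_le_aleph_one {α : Ordinal.{0}} (hα : α < ω_ 2) : #(Iio α) ≤ ℵ_ 1 := by
  rw [Cardinal.mk_Iio_ordinal]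
  have : α.card ≤ ℵ_ 1 := by
    rw [← Order.lt_succ_iff, Cardinal.succ_aleph, one_add_one_eq_two, ← Cardinal.lt_ord,
      Cardinal.ord_aleph]
    exact hα
  simpa using Cardinal.lift_le.{1}.2 this

theorem isSuccLimit_omega_two : IsSuccLimit (ω_ 2 : Ordinal.{0}) :=
  Cardinal.isSuccLimit_omega 2

/-- Regularity of `ω₂`: a family of fewer than `ℵ₂` ordinals below `ω₂` is bounded. -/
theorem exists_bound_lt_omega_two {ι : Type 1} (hι : #ι < ℵ_ 2) (f : ι → Ordinal.{0})
    (hf : ∀ i, f i < ω_ 2) : ∃ α < ω_ 2, ∀ i, f i < α := by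
  let g : ι → OmegaTwo := fun i => ⟨succ (f i), isSuccLimit_omega_two.succ_lt (hf i)⟩
  have hg : ¬ IsCofinal (range g) := by
    intro hc
    have h := (Order.cof_le hc).trans Cardinal.mk_range_le
    rw [cof_omegaTwo] at h
    exact absurd hι (not_lt.2 h)
  obtain ⟨a, ha⟩ := not_isCofinal_iff.1 hg
  exact ⟨a.1, a.2, fun i => (lt_succ (f i)).trans (ha (g i) ⟨i, rfl⟩)⟩

theorem mk_span_int_le {M : Type 1} [AddCommGroup M] (s : Set M) {κ : Cardinal.{1}}
    (hκ : ℵ₀ ≤ κ) (hs : #s ≤ κ) : #(Submodule.span ℤ s) ≤ κ := by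
  rcases s.eq_empty_or_nonempty with rfl | hne
  · rw [Submodule.span_empty]
    exact (Cardinal.lt_aleph0_of_finite _).le.trans hκ
  have : Nonempty s := hne.to_subtype
  have hsurj : Function.Surjective (Finsupp.linearCombination ℤ ((↑) : s → M)).rangeRestrict :=
    LinearMap.surjective_rangeRestrict _
  have h1 := Cardinal.mk_le_of_surjective hsurj
  rw [Finsupp.range_linearCombination, Subtype.range_coe] at h1
  refine h1.trans ?_
  rw [Cardinal.mk_finsupp_lift_of_infinite']
  simpa using ⟨hs, hκ⟩

/-! ### Submodules of free modules over a principal ideal domain -/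

/-- A submodule of a free module over a principal ideal domain is free, in any rank. With respect
to a well-ordered basis, choose for each index `i` an element of the submodule with last nonzero
coordinate at `i` and this coordinate a generator of the ideal of all possible ones. -/
theorem Submodule.free_of_isPrincipalIdealRing {R M : Type*} [CommRing R] [IsDomain R]
    [IsPrincipalIdealRing R] [AddCommGroup M] [Module R M] [Module.Free R M] (N : Submodule R M) :
    Module.Free R N := by
  classical
  obtain ⟨ι, b⟩ := Module.Free.exists_basis (R := R) (M := M)
  obtain ⟨_, hwf⟩ := exists_wellFoundedLT ι
  let T : ι → Submodule R M := fun i =>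
    { carrier := {x | x ∈ N ∧ ∀ j, i < j → b.repr x j = 0}
      add_mem' := fun {x y} hx hy => ⟨add_mem hx.1 hy.1, fun j hj => by
        simp [hx.2 j hj, hy.2 j hj]⟩
      zero_mem' := ⟨zero_mem _, fun j hj => by simp⟩
      smul_mem' := fun a x hx => ⟨N.smul_mem a hx.1, fun j hj => by simp [hx.2 j hj]⟩ }
  let J : ι → Submodule R R := fun i => (T i).map (b.coord i)
  have hn : ∀ i, ∃ x ∈ T i, b.repr x i = Submodule.IsPrincipal.generator (J i) := by
    intro i
    obtain ⟨x, hx, hxe⟩ := Submodule.mem_map.1 (Submodule.IsPrincipal.generator_mem (J i))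
    exact ⟨x, hx, by rw [← hxe, b.coord_apply]⟩
  choose n hnT hn using hn
  let K : Set ι := {i | Submodule.IsPrincipal.generator (J i) ≠ 0}
  let v : K → N := fun i => ⟨n i, (hnT i).1⟩
  have hli : LinearIndependent R v := by
    rw [linearIndependent_iff]
    intro l hl
    by_contra hne
    have hsupp : l.support.Nonempty := Finsupp.support_nonempty_iff.2 hne
    obtain ⟨i, hi, hmax⟩ := Finset.exists_max_image l.support id hsupp
    have h0 : b.repr ((Finsupp.linearCombination R v l : N) : M) i = 0 := by
      rw [hl]; simp
    rw [Finsupp.linearCombination_apply, Finsupp.sum, Submodule.coe_sum, map_sum,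
      Finsupp.finsetSum_apply, Finset.sum_eq_single i] at h0
    · simp only [Submodule.coe_smul, map_smul, Finsupp.smul_apply, smul_eq_mul, v, hn,
        mul_eq_zero] at h0
      rcases h0 with h0 | h0
      · exact (Finsupp.mem_support_iff.1 hi) h0
      · exact i.2 h0
    · intro j hj hji
      have hlt : j < i := lt_of_le_of_ne (hmax j hj) hji
      simp [v, (hnT j).2 i hlt]
    · exact fun h => absurd hi h
  have hspan : ∀ i, ∀ x : N, x.1 ∈ T i → x ∈ Submodule.span R (range v) := by
    intro i
    induction i using WellFoundedLT.induction with
    | ind i ih =>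
    intro x hx
    have low : ∀ z : N, z.1 ∈ T i → b.repr z.1 i = 0 → z ∈ Submodule.span R (range v) := by
      intro z hzT hzi
      by_cases h0 : z = 0
      · rw [h0]; exact zero_mem _
      have hs : (b.repr z.1).support.Nonempty := by
        rw [Finsupp.support_nonempty_iff]
        simpa using h0
      obtain ⟨k, hk, hkmax⟩ := Finset.exists_max_image _ id hs
      have hki : k < i := by
        rcases lt_trichotomy k i with h | h | h
        · exact h
        · rw [h] at hk
          exact absurd hzi (Finsupp.mem_support_iff.1 hk)
        · exact absurd (hzT.2 k h) (Finsupp.mem_support_iff.1 hk)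
      refine ih k hki _ ⟨z.2, fun j hj => ?_⟩
      by_contra hc
      exact absurd (hkmax j (Finsupp.mem_support_iff.2 hc)) (not_le.2 hj)
    obtain ⟨r, hr⟩ := (Submodule.IsPrincipal.mem_iff_eq_smul_generator (J i)).1
      (Submodule.mem_map_of_mem (f := b.coord i) hx)
    rw [b.coord_apply] at hr
    by_cases hi : i ∈ K
    · rw [← sub_add_cancel x (r • v ⟨i, hi⟩)]
      refine add_mem (low _ ((T i).sub_mem hx ((T i).smul_mem r (hnT i))) ?_)
        (Submodule.smul_mem _ _ (Submodule.subset_span ⟨⟨i, hi⟩, rfl⟩))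
      simp [v, hr, hn]
    · exact low x hx (by rw [hr, not_not.1 hi, smul_zero])
  refine Module.Free.of_basis (Module.Basis.mk hli fun x _ => ?_)
  by_cases h0 : x = 0
  · rw [h0]; exact zero_mem _
  · have hs : (b.repr x.1).support.Nonempty := by
      rw [Finsupp.support_nonempty_iff]
      simpa using h0
    obtain ⟨k, hk, hkmax⟩ := Finset.exists_max_image _ id hs
    refine hspan k x ⟨x.2, fun j hj => ?_⟩
    by_contra hc
    exact absurd (hkmax j (Finsupp.mem_support_iff.2 hc)) (not_le.2 hj)

/-! ### The ladder group is almost free -/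

section LadderGroup

variable {E : Set OmegaTwo} {η : OmegaTwo → ℕ → OmegaTwo}

theorem zero_lt_omega_two : (0 : Ordinal.{0}) < ω_ 2 := isSuccLimit_omega_two.bot_lt

theorem filtrationGroup_zero : filtrationGroup E η 0 = ⊥ := by
  rw [filtrationGroup, Submodule.span_eq_bot]
  rintro v (⟨γ, hγ, -⟩ | ⟨δ, -, hδ, -⟩)
  · exact absurd hγ not_lt_zero
  · exact absurd hδ not_lt_zero

/-- Every stage of the filtration below `ω₂` has a unitriangular basis indexed by `α`. -/
theorem exists_isUnitriangular_basis (h : IsLadderSystem E η) (hE : IsNonReflecting E)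
    (h0 : ∀ δ ∈ E, IsSuccLimit δ.1) (α : OmegaTwo) :
    ∃ y : OmegaTwo → OmegaTwo → ℤ, IsUnitriangular y univ ∧
      filtrationGroup E η α.1 = Submodule.span ℤ (y '' Iio α) := by
  obtain ⟨y, hy, hmem, hle⟩ := exists_isUnitriangular_generators h hE
    (β := ⟨0, zero_lt_omega_two⟩) (α := α) (zero_le (a := α.1))
    (fun h => (h0 _ h).ne_bot rfl)
  refine ⟨y, hy, le_antisymm ?_ ?_⟩
  · refine hle.trans ?_
    rw [filtrationGroup_zero, bot_sup_eq]
    exact Submodule.span_mono (image_mono fun ν hν => hν.2)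
  · apply Submodule.span_le.2
    rintro _ ⟨ν, hν, rfl⟩
    exact hmem ν hν

theorem IsUnitriangular.linearIndependent {y : OmegaTwo → OmegaTwo → ℤ}
    (hy : IsUnitriangular y univ) : LinearIndependent ℤ y := by
  rw [linearIndependent_iff]
  intro l hl
  ext ν
  rw [Finsupp.linearCombination_apply] at hl
  have := hy.dvd_coeff l (fun _ _ => mem_univ _) 0 (fun i _ => by rw [hl]; simp) ν
  simpa using this

theorem exists_lt_omega_two_mem_filtrationGroup {v : OmegaTwo → ℤ}
    (hv : v ∈ filtrationGroup E η (ω_ 2)) :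
    ∃ α : OmegaTwo, v ∈ filtrationGroup E η α.1 := by
  obtain ⟨α, hα, hv⟩ := exists_lt_mem_filtrationGroup isSuccLimit_omega_two hv
  exact ⟨⟨α, hα⟩, hv⟩

theorem isPureSubgroup_filtrationGroup (h : IsLadderSystem E η) (hE : IsNonReflecting E)
    (h0 : ∀ δ ∈ E, IsSuccLimit δ.1) :
    IsPureSubgroup (filtrationGroup E η (ω_ 2)).toAddSubgroup := by
  intro n a ha
  rcases eq_or_ne n 0 with rfl | hn
  · exact ⟨0, zero_mem _, by simp⟩
  refine ⟨a, ?_, rfl⟩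
  obtain ⟨α, hα⟩ := exists_lt_omega_two_mem_filtrationGroup
    (show n • a ∈ filtrationGroup E η (ω_ 2) from ha)
  obtain ⟨y, hy, hspan⟩ := exists_isUnitriangular_basis h hE h0 α
  rw [hspan, Finsupp.mem_span_image_iff_linearCombination] at hα
  obtain ⟨c, hc, hca⟩ := hα
  have hdvd : ∀ ν, (n : ℤ) ∣ c ν := hy.dvd_coeff c (fun _ _ => mem_univ _) n fun i _ => by
    rw [← Finsupp.linearCombination_apply, hca]
    exact ⟨a i, by simp⟩
  have hsum : n • a = n • c.sum fun ν k => (k / n) • y ν := by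
    rw [← hca, Finsupp.linearCombination_apply, Finsupp.sum, Finsupp.sum, Finset.smul_sum]
    refine Finset.sum_congr rfl fun ν _ => ?_
    rw [← natCast_zsmul, smul_smul, Int.mul_ediv_cancel' (hdvd ν)]
  have ha' : a = c.sum fun ν k => (k / n) • y ν := nsmul_right_injective hn hsum
  have hmem : a ∈ filtrationGroup E η α.1 := by
    rw [ha', hspan]
    refine Submodule.sum_mem _ fun ν hν => Submodule.smul_mem _ _ (Submodule.subset_span ?_)
    exact ⟨ν, (Finsupp.mem_supported _ _).1 hc hν, rfl⟩
  exact filtrationGroup_mono α.2.le hmem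

theorem ladderGroup_eq_filtrationGroup (h : IsLadderSystem E η) (hE : IsNonReflecting E)
    (h0 : ∀ δ ∈ E, IsSuccLimit δ.1) :
    ladderGroup E η = (filtrationGroup E η (ω_ 2)).toAddSubgroup := by
  apply le_antisymm
  · refine sInf_le ⟨?_, isPureSubgroup_filtrationGroup h hE h0⟩
    rintro v (⟨β, rfl⟩ | ⟨δ, hδ, rfl⟩)
    · exact unitVector_mem_filtrationGroup β.2
    · change ladderVector (η δ) ∈ filtrationGroup E η (ω_ 2)
      rw [← tailVector_zero]
      exact tailVector_mem_filtrationGroup hδ δ.2 0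
  · refine le_sInf fun P hP => ?_
    obtain ⟨hsub, hpure⟩ := hP
    have htail : ∀ δ ∈ E, ∀ n, tailVector (η δ) n ∈ P := by
      intro δ hδ n
      induction n with
      | zero =>
        rw [tailVector_zero]
        exact hsub (Or.inr ⟨δ, hδ, rfl⟩)
      | succ n ih =>
        rw [tailVector_eq (h δ hδ).1 n] at ih
        have h2 : (2 : ℕ) • tailVector (η δ) (n + 1) ∈ P := by
          have := sub_mem ih (hsub (Or.inl ⟨η δ n, rfl⟩))
          rw [add_sub_cancel_left] at this
          simpa [← natCast_zsmul] using this
        obtain ⟨b, hb, hb2⟩ := hpure 2 _ h2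
        rwa [← nsmul_right_injective two_ne_zero hb2]
    have hle : filtrationGroup E η (ω_ 2) ≤ AddSubgroup.toIntSubmodule P := by
      apply Submodule.span_le.2
      rintro v (⟨β, -, rfl⟩ | ⟨δ, hδ, -, n, rfl⟩)
      · exact hsub (Or.inl ⟨β, rfl⟩)
      · exact htail δ hδ n
    exact hle

theorem mk_filtrationGroup_le {κ : Cardinal.{1}} (hκ : ℵ₀ ≤ κ) {α : Ordinal.{0}}
    (hα : #(Iio α) ≤ κ) : #(filtrationGroup E η α) ≤ κ := by
  apply mk_span_int_le _ hκ
  have hsub : ({v | ∃ β : OmegaTwo, β.1 < α ∧ v = unitVector β} ∪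
      {v | ∃ δ ∈ E, δ.1 < α ∧ ∃ n, v = tailVector (η δ) n}) ⊆
      range fun p : {β : OmegaTwo // β.1 < α} × Option ℕ =>
        p.2.elim (unitVector p.1.1) fun n => tailVector (η p.1.1) n := by
    rintro v (⟨γ, hγ, rfl⟩ | ⟨δ, -, hδα, n, rfl⟩)
    · exact ⟨⟨⟨γ, hγ⟩, none⟩, rfl⟩
    · exact ⟨⟨⟨δ, hδα⟩, some n⟩, rfl⟩
  have hinj : #{β : OmegaTwo // β.1 < α} ≤ #(Iio α) :=
    Cardinal.mk_le_of_injective (f := fun β : {β : OmegaTwo // β.1 < α} => (⟨β.1.1, β.2⟩ : Iio α))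
      fun a b hab => Subtype.ext (Subtype.ext (congrArg (fun x : Iio α => x.1) hab))
  refine (Cardinal.mk_le_mk_of_subset hsub).trans (Cardinal.mk_range_le.trans ?_)
  rw [Cardinal.mk_prod]
  refine (mul_le_mul' (Cardinal.lift_le.2 (hinj.trans hα)) (Cardinal.lift_le.2
    (Cardinal.mk_le_aleph0 (α := Option ℕ)))).trans ?_
  simp only [Cardinal.lift_aleph0, Cardinal.lift_uzero]
  rw [Cardinal.mul_aleph0_eq hκ]

theorem mk_ladderGroup (h : IsLadderSystem E η) (hE : IsNonReflecting E)
    (h0 : ∀ δ ∈ E, IsSuccLimit δ.1) : #(ladderGroup E η) = ℵ_ 2 := by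
  rw [ladderGroup_eq_filtrationGroup h hE h0]
  apply le_antisymm
  · exact mk_filtrationGroup_le (Cardinal.aleph0_le_aleph 2) mk_omegaTwo.le
  · rw [← mk_omegaTwo]
    refine Cardinal.mk_le_of_injective (f := fun β : OmegaTwo =>
      (⟨unitVector β, unitVector_mem_filtrationGroup β.2⟩ :
        (filtrationGroup E η (ω_ 2)).toAddSubgroup)) fun a b hab => ?_
    have hab' : unitVector a = unitVector b := congrArg Subtype.val hab
    by_contra hne
    have h1 := congrFun hab' a
    rw [unitVector_self, unitVector_of_ne hne] at h1
    exact one_ne_zero h1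

theorem free_filtrationGroup (h : IsLadderSystem E η) (hE : IsNonReflecting E)
    (h0 : ∀ δ ∈ E, IsSuccLimit δ.1) (α : OmegaTwo) :
    Module.Free ℤ (filtrationGroup E η α.1) := by
  obtain ⟨y, hy, hspan⟩ := exists_isUnitriangular_basis h hE h0 α
  have hli : LinearIndependent ℤ fun ν : Iio α => y ν :=
    hy.linearIndependent.comp _ Subtype.val_injective
  have hrange : range (fun ν : Iio α => y ν) = y '' Iio α := by
    rw [image_eq_range]
  rw [hspan, ← hrange]
  exact Module.Free.of_basis (Module.Basis.span hli)

theorem isAlmostFree_ladderGroup (h : IsLadderSystem E η) (hE : IsNonReflecting E)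
    (h0 : ∀ δ ∈ E, IsSuccLimit δ.1) : IsAlmostFree (ladderGroup E η) := by
  intro H hH
  rw [mk_ladderGroup h hE h0] at hH
  have hG := ladderGroup_eq_filtrationGroup h hE h0
  have hstage : ∀ x : H, ∃ α : OmegaTwo, (x.1.1 : OmegaTwo → ℤ) ∈ filtrationGroup E η α.1 := by
    intro x
    apply exists_lt_omega_two_mem_filtrationGroup
    exact hG.le x.1.2
  choose f hf using hstage
  obtain ⟨α, hα, hfα⟩ := exists_bound_lt_omega_two hH (fun x => (f x).1) fun x => (f x).2
  have hmem : ∀ x : H, (x.1.1 : OmegaTwo → ℤ) ∈ filtrationGroup E η α := fun x =>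
    filtrationGroup_mono (hfα x).le (hf x)
  have := free_filtrationGroup h hE h0 ⟨α, hα⟩
  let φ : H →+ filtrationGroup E η α :=
    { toFun := fun x => ⟨x.1.1, hmem x⟩
      map_zero' := rfl
      map_add' := fun _ _ => rfl }
  have hinj : Function.Injective φ.toIntLinearMap := by
    intro a b hab
    exact Subtype.ext (Subtype.ext (congrArg (fun z : filtrationGroup E η α => z.1) hab))
  have := Submodule.free_of_isPrincipalIdealRing (LinearMap.range φ.toIntLinearMap)
  exact Module.Free.of_equiv (LinearEquiv.ofInjective φ.toIntLinearMap hinj).symm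

end LadderGroup

/-! ### Two criteria for games of length `ω₁` -/

namespace EFGame

universe u v w w' t

section

variable {M : Type w} {N : Type w'}

/-- `x` and `y` lie in different structures and are related by `π`, in whichever order. -/
def Matches (π : Set (M × N)) (x y : M ⊕ N) : Prop :=
  ∃ ab ∈ π, (x = Sum.inl ab.1 ∧ y = Sum.inr ab.2) ∨ (x = Sum.inr ab.2 ∧ y = Sum.inl ab.1)

/-- The elements of either structure that `π` relates to something. -/
def field (π : Set (M × N)) : Set (M ⊕ N) :=
  {x | ∃ y, Matches π x y}

theorem Matches.mono {π ρ : Set (M × N)} (h : π ⊆ ρ) {x y : M ⊕ N} (hxy : Matches π x y) :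
    Matches ρ x y := by
  obtain ⟨ab, hab, hxy⟩ := hxy
  exact ⟨ab, h hab, hxy⟩

theorem matches_inl_inr {π : Set (M × N)} {a : M} {b : N} :
    Matches π (Sum.inl a) (Sum.inr b) ↔ (a, b) ∈ π := by
  constructor
  · rintro ⟨⟨a', b'⟩, hab, ⟨h1, h2⟩ | ⟨h1, -⟩⟩
    · obtain rfl := Sum.inl.inj h1
      obtain rfl := Sum.inr.inj h2
      exact hab
    · cases h1
  · exact fun h => ⟨(a, b), h, Or.inl ⟨rfl, rfl⟩⟩

theorem matches_inr_inl {π : Set (M × N)} {a : M} {b : N} :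
    Matches π (Sum.inr b) (Sum.inl a) ↔ (a, b) ∈ π := by
  constructor
  · rintro ⟨⟨a', b'⟩, hab, ⟨h1, -⟩ | ⟨h1, h2⟩⟩
    · cases h1
    · obtain rfl := Sum.inr.inj h1
      obtain rfl := Sum.inl.inj h2
      exact hab
  · exact fun h => ⟨(a, b), h, Or.inr ⟨rfl, rfl⟩⟩

theorem not_matches_inl_inl {π : Set (M × N)} {a a' : M} :
    ¬ Matches π (Sum.inl a) (Sum.inl a') := by
  rintro ⟨_, _, ⟨_, h⟩ | ⟨h, _⟩⟩ <;> cases h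

theorem not_matches_inr_inr {π : Set (M × N)} {b b' : N} :
    ¬ Matches π (Sum.inr b) (Sum.inr b') := by
  rintro ⟨_, _, ⟨h, _⟩ | ⟨_, h⟩⟩ <;> cases h

theorem inl_mem_field {π : Set (M × N)} {a : M} : Sum.inl a ∈ field π ↔ ∃ b, (a, b) ∈ π := by
  constructor
  · rintro ⟨a' | b, h⟩
    · exact absurd h not_matches_inl_inl
    · exact ⟨b, matches_inl_inr.1 h⟩
  · rintro ⟨b, h⟩
    exact ⟨_, matches_inl_inr.2 h⟩

theorem inr_mem_field {π : Set (M × N)} {b : N} : Sum.inr b ∈ field π ↔ ∃ a, (a, b) ∈ π := by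
  constructor
  · rintro ⟨a | b', h⟩
    · exact ⟨a, matches_inr_inl.1 h⟩
    · exact absurd h not_matches_inr_inr
  · rintro ⟨a, h⟩
    exact ⟨_, matches_inr_inl.2 h⟩

variable {L : FirstOrder.Language.{u, v}} [L.IsRelational] [L.Structure M] [L.Structure N]

theorem IsPartialIso.mono {π ρ : Set (M × N)} (hρ : IsPartialIso L ρ) (h : π ⊆ ρ) :
    IsPartialIso L π :=
  ⟨fun p hp q hq => hρ.1 p (h hp) q (h hq), fun n R a b hab => hρ.2 n R a b fun i => h (hab i)⟩

theorem IsPartialIso.matches_unique {π : Set (M × N)} (hπ : IsPartialIso L π) {x y z : M ⊕ N}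
    (hy : Matches π x y) (hz : Matches π x z) : y = z := by
  obtain ⟨p, hp, ⟨hx, rfl⟩ | ⟨hx, rfl⟩⟩ := hy <;> obtain ⟨q, hq, ⟨hx', rfl⟩ | ⟨hx', rfl⟩⟩ := hz <;>
    rw [hx] at hx'
  · rw [(hπ.1 p hp q hq).1 (Sum.inl.inj hx')]
  · cases hx'
  · cases hx'
  · rw [(hπ.1 p hp q hq).2 (Sum.inr.inj hx')]

theorem wonByExists_of_matches {γ : Ordinal.{t}} {π : Set (M × N)} (hπ : IsPartialIso L π)
    {p : Iio γ → Round M N} (hp : ∀ α, Matches π (p α).1 (p α).2) : WonByExists L p := by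
  refine ⟨fun α => ?_, hπ.mono ?_⟩
  · obtain ⟨ab, -, ⟨h1, h2⟩ | ⟨h1, h2⟩⟩ := hp α <;> rw [h1, h2] <;> rfl
  · rintro ⟨a, b⟩ ⟨α, h | h⟩
    · have := hp α
      rw [h] at this
      exact matches_inl_inr.1 this
    · have := hp α
      rw [h] at this
      exact matches_inr_inl.1 this

theorem WonByExists.matches {γ : Ordinal.{t}} {p : Iio γ → Round M N} (h : WonByExists L p)
    (α : Iio γ) : Matches (playRel p) (p α).1 (p α).2 := by
  have h1 := h.1 α
  rcases hx : (p α).1 with a | b <;> rcases hy : (p α).2 with a' | b' <;> rw [hx, hy] at h1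
  · simp at h1
  · exact matches_inl_inr.2 ⟨α, Or.inl (Prod.ext hx hy)⟩
  · exact matches_inr_inl.2 ⟨α, Or.inr (Prod.ext hx hy)⟩
  · simp at h1

/-- A play can be prescribed by recursion on the rounds. -/
theorem exists_play {γ : Ordinal.{t}}
    (F : (α : Iio γ) → (Iio (α : Ordinal.{t}) → Round M N) → Round M N) :
    ∃ p : Iio γ → Round M N, ∀ α, p α = F α (initialPart p α) := by
  let G : (α : Iio γ) → ((β : Iio γ) → β < α → Round M N) → Round M N := fun α q =>
    F α fun β => q ⟨β.1, lt_trans (mem_Iio.1 β.2) (mem_Iio.1 α.2)⟩ β.2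
  exact ⟨(wellFounded_lt (α := Iio γ)).fix G, fun α => WellFounded.fix_eq _ G α⟩

theorem initialPart_congr {γ : Ordinal.{t}} {p q : Iio γ → Round M N} {α : Iio γ}
    (h : ∀ β < α, p β = q β) : initialPart p α = initialPart q α := by
  funext β
  exact h _ β.2

theorem countable_Iio_of_lt_omega_one {α : Ordinal.{t}} (hα : α < ω_ 1) : (Iio α).Countable := by
  rw [← Cardinal.le_aleph0_iff_set_countable, Cardinal.mk_Iio_ordinal]
  rw [← Cardinal.lift_aleph0.{t + 1, t}, Cardinal.lift_le, ← Order.lt_succ_iff,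
    Cardinal.succ_aleph0, ← Cardinal.lt_ord, Cardinal.ord_aleph]
  exact hα

/-- A criterion for `∀` not to win. Suppose `∃` has a system of partial isomorphisms to follow.
Against a given strategy of `∀`, following `π γ` as long as possible produces certain moves `X γ`
of `∀`. If for some `δ` the relation `π δ` is a union of a countably directed family of those
`π γ` whose moves `X γ` lie in the field of `π δ`, then `∃` wins by following `π δ`: up to each
countable stage she has followed one of these `π γ`, so that the next move of `∀` is in `X γ`. -/
theorem not_forallWins_of_countably_directed {ι : Type*} (π : ι → Set (M × N))
    (hπ : ∀ d, IsPartialIso L (π d))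
    (h : ∀ X : ι → Iio (ω_ 1 : Ordinal.{t}) → M ⊕ N, ∃ (δ : ι) (S : Set ι),
      (∀ γ ∈ S, π γ ⊆ π δ) ∧
      (∀ T ⊆ field (π δ), T.Countable → ∃ γ ∈ S, T ⊆ field (π γ)) ∧
      ∀ γ ∈ S, ∀ α, X γ α ∈ field (π δ)) :
    ¬ ForallWins L (ω_ 1 : Ordinal.{t}) M N := by
  rintro ⟨τ, hτ⟩
  have hr : ∀ d, ∃ r : M ⊕ N → M ⊕ N, ∀ x ∈ field (π d), Matches (π d) x (r x) := by
    intro d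
    have : ∀ x, ∃ y, x ∈ field (π d) → Matches (π d) x y := by
      intro x
      by_cases hx : x ∈ field (π d)
      · obtain ⟨y, hy⟩ := hx
        exact ⟨y, fun _ => hy⟩
      · exact ⟨x, fun hx' => absurd hx' hx⟩
    choose r hr using this
    exact ⟨r, hr⟩
  choose r hr using hr
  have hp : ∀ d, ∃ p : Iio (ω_ 1 : Ordinal.{t}) → Round M N,
      ∀ α, p α = (τ α (initialPart p α), r d (τ α (initialPart p α))) := fun d =>
    exists_play fun α q => (τ α q, r d (τ α q))
  choose p hp using hp
  obtain ⟨δ, S, hS, hT, hX⟩ := h fun d α => (p d α).1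
  have hp1 : ∀ d α, (p d α).1 = τ α (initialPart (p d) α) := fun d α => by rw [hp d α]
  have hp2 : ∀ d α, (p d α).2 = r d (p d α).1 := fun d α => by rw [hp d α]
  have key : ∀ α, (p δ α).1 ∈ field (π δ) := by
    intro α
    induction α using WellFoundedLT.induction with
    | ind α ih =>
    have hcount : ((fun β => (p δ β).1) '' Iio α).Countable := by
      apply Set.Countable.image
      have := (countable_Iio_of_lt_omega_one (mem_Iio.1 α.2)).preimage
        (Subtype.val_injective (p := (· ∈ Iio (ω_ 1 : Ordinal.{t}))))
      exact this
    obtain ⟨γ, hγ, hsub⟩ := hT _ (by rintro _ ⟨β, hβ, rfl⟩; exact ih β hβ) hcount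
    have heq : ∀ β < α, p δ β = p γ β := by
      intro β
      induction β using WellFoundedLT.induction with
      | ind β ihβ =>
      intro hβ
      have h1 : (p δ β).1 = (p γ β).1 := by
        rw [hp1, hp1, initialPart_congr fun ε hε => ihβ ε hε (hε.trans hβ)]
      refine Prod.ext h1 ?_
      have h2 := hr γ _ (hsub ⟨β, hβ, rfl⟩)
      rw [hp2, hp2, ← h1]
      exact (hπ δ).matches_unique (hr δ _ (ih β hβ)) (h2.mono (hS γ hγ))
    rw [hp1, initialPart_congr heq, ← hp1]
    exact hX γ hγ α
  refine hτ (p δ) (hp1 δ) (wonByExists_of_matches (hπ δ) fun α => ?_)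
  rw [hp2]
  exact hr δ _ (key α)

/-- What a winning strategy of `∃` yields: if a countable set `U` is closed under the answers `r`
of the strategy to finite sequences of moves, then `∀` can play `U` in the first `ω` rounds and any
countable set `V` afterwards. The resulting partial isomorphism maps `U` into itself. -/
theorem ExistsWins.exists_isPartialIso (h : ExistsWins L (ω_ 1 : Ordinal.{t}) M N) (d : M ⊕ N) :
    ∃ r : List (M ⊕ N) → M ⊕ N, ∀ U V : Set (M ⊕ N), U.Countable → V.Countable → U.Nonempty →
      (∀ l : List (M ⊕ N), (∀ x ∈ l, x ∈ U) → r l ∈ U) →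
      ∃ π : Set (M × N), IsPartialIso L π ∧ U ∪ V ⊆ field π ∧
        ∀ x y, Matches π x y → x ∈ U → y ∈ U := by
  obtain ⟨σ, hσ⟩ := h
  have hP : ∀ x : Ordinal.{t} → M ⊕ N, ∃ p : Iio (ω_ 1 : Ordinal.{t}) → Round M N,
      ∀ α, p α = (x α, σ α (initialPart p α) (x α)) := fun x =>
    exists_play fun α q => (x α, σ α q (x α))
  choose P hP using hP
  have hcongr : ∀ x x' : Ordinal.{t} → M ⊕ N, ∀ α : Iio (ω_ 1 : Ordinal.{t}),
      (∀ β ≤ α, x β.1 = x' β.1) → P x α = P x' α := by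
    intro x x' α
    induction α using WellFoundedLT.induction with
    | ind α ih =>
    intro hx
    rw [hP x α, hP x' α, hx α le_rfl,
      initialPart_congr fun β hβ => ih β hβ fun ε hε => hx ε (hε.trans hβ.le)]
  have hlt : ∀ n : ℕ, (n : Ordinal.{t}) < ω_ 1 := fun n =>
    (Ordinal.natCast_lt_omega0 n).trans Ordinal.omega0_lt_omega_one
  have hlt' : ∀ n : ℕ, ω + (n : Ordinal.{t}) < ω_ 1 := fun n =>
    Ordinal.isPrincipal_add_omega 1 Ordinal.omega0_lt_omega_one (hlt n)
  have hwin : ∀ x, WonByExists L (P x) := fun x => hσ (P x) fun α => by rw [hP x α]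
  let finMoves : List (M ⊕ N) → Ordinal.{t} → M ⊕ N := fun l =>
    Function.extend (fun n : ℕ => (n : Ordinal.{t})) (fun n => l.getD n d) fun _ => d
  refine ⟨fun l => (P (finMoves l) ⟨((l.length - 1 : ℕ) : Ordinal.{t}), hlt _⟩).2,
    fun U V hU hV hne hcl => ?_⟩
  obtain ⟨f, hf⟩ := hU.exists_eq_range hne
  obtain ⟨g, hg⟩ := (hV.insert d).exists_eq_range (insert_nonempty d V)
  let ix : ℕ ⊕ ℕ → Ordinal.{t} := Sum.elim (fun n => (n : Ordinal.{t})) fun n => ω + n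
  have hix : Function.Injective ix := by
    rintro (m | m) (n | n) hmn
    · exact congrArg Sum.inl (Nat.cast_injective (R := Ordinal.{t}) hmn)
    · exact absurd hmn ((Ordinal.natCast_lt_omega0 m).trans_le le_self_add).ne
    · exact absurd hmn ((Ordinal.natCast_lt_omega0 n).trans_le le_self_add).ne'
    · exact congrArg Sum.inr (Nat.cast_injective (R := Ordinal.{t}) (add_left_cancel hmn))
  let x : Ordinal.{t} → M ⊕ N := Function.extend ix (Sum.elim f g) fun _ => d
  have hxl : ∀ n : ℕ, x n = f n := fun n => hix.extend_apply (Sum.elim f g) (fun _ => d) (Sum.inl n)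
  have hxr : ∀ n : ℕ, x (ω + n) = g n := fun n =>
    hix.extend_apply (Sum.elim f g) (fun _ => d) (Sum.inr n)
  have hmatch := (hwin x).matches
  have h1 : ∀ α, (P x α).1 = x α := fun α => by rw [hP x α]
  have hUfin : ∀ n : ℕ, (P x ⟨n, hlt n⟩).2 ∈ U := by
    intro n
    have hl := hcl (List.ofFn fun i : Fin (n + 1) => f i) (by
      intro z hz
      obtain ⟨i, rfl⟩ := (List.mem_ofFn' _ _).1 hz
      rw [hf]
      exact ⟨i, rfl⟩)
    have hlen : ((List.ofFn fun i : Fin (n + 1) => f i).length - 1) = n := by simp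
    simp only [hlen] at hl
    rw [hcongr x (finMoves (List.ofFn fun i : Fin (n + 1) => f i)) ⟨n, hlt n⟩ ?_]
    · exact hl
    intro β hβ
    obtain ⟨k, hk⟩ := Ordinal.lt_omega0.1
      ((show β.1 ≤ (n : Ordinal.{t}) from hβ).trans_lt (Ordinal.natCast_lt_omega0 n))
    have hkn : k ≤ n := by
      have : β.1 ≤ (n : Ordinal.{t}) := hβ
      rw [hk] at this
      exact_mod_cast this
    rw [hk, hxl]
    have := (Nat.cast_injective (R := Ordinal.{t})).extend_apply
      (fun m => (List.ofFn fun i : Fin (n + 1) => f i).getD m d) (fun _ => d) k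
    simp only [finMoves]
    rw [this, List.getD_eq_getElem _ _ (by rw [List.length_ofFn]; omega), List.getElem_ofFn]
  refine ⟨playRel (P x), (hwin x).2, ?_, ?_⟩
  · rintro z (hz | hz)
    · rw [hf] at hz
      obtain ⟨n, rfl⟩ := hz
      have := hmatch ⟨n, hlt n⟩
      rw [h1, hxl] at this
      exact ⟨_, this⟩
    · have hz' : z ∈ range g := hg ▸ mem_insert_of_mem d hz
      obtain ⟨n, rfl⟩ := hz'
      have := hmatch ⟨ω + n, hlt' n⟩
      rw [h1, hxr] at this
      exact ⟨_, this⟩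
  · intro z y hzy hz
    rw [hf] at hz
    obtain ⟨n, rfl⟩ := hz
    have := hmatch ⟨n, hlt n⟩
    rw [h1, hxl] at this
    rw [(hwin x).2.matches_unique hzy this]
    exact hUfin n

end

end EFGame

/-! ### Closure points and countable closures -/

theorem isClub_closurePoints (g : OmegaTwo → OmegaTwo) : IsClub {δ | ∀ β < δ, g β < δ} := by
  constructor
  · intro t ht _ _ a ha β hβ
    obtain ⟨x, hx, hβx⟩ := (lt_isLUB_iff ha).1 hβ
    exact (ht hx β hβx).trans_le (ha.1 hx)
  · intro a
    have hstep : ∀ x : OmegaTwo, ∃ y : OmegaTwo, x < y ∧ ∀ β ≤ x, g β < y := by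
      intro x
      have hcard : #(Iic x) < ℵ_ 2 := by
        refine lt_of_le_of_lt ?_ aleph_one_lt_aleph_two
        refine (Cardinal.mk_le_of_injective (f := fun β : Iic x => (⟨β.1.1, lt_of_le_of_lt
          (show β.1.1 ≤ x.1 from β.2) (lt_succ x.1)⟩ : Iio (succ x.1))) ?_).trans
          (mk_Iio_le_aleph_one (isSuccLimit_omega_two.succ_lt x.2))
        intro β γ h
        exact Subtype.ext (Subtype.ext (congrArg (fun z : Iio (succ x.1) => z.1) h))
      obtain ⟨α, hα, hlt⟩ := exists_bound_lt_omega_two hcard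
        (fun β => max x.1 (g β.1).1) fun β => max_lt x.2 (g β.1).2
      exact ⟨⟨α, hα⟩, (le_max_left _ _).trans_lt (hlt ⟨x, mem_Iic.2 le_rfl⟩),
        fun β hβ => (le_max_right _ _).trans_lt (hlt ⟨β, hβ⟩)⟩
    choose h hlt hg using hstep
    let s : ℕ → OmegaTwo := fun n => h^[n] a
    have hs : ∀ n, s (n + 1) = h (s n) := fun n => Function.iterate_succ_apply' h n a
    obtain ⟨b, hb, hsb⟩ := exists_bound_lt_omega_two (ι := ULift.{1} ℕ)
      ((Cardinal.mk_le_aleph0).trans_lt (Cardinal.aleph0_lt_aleph.2 two_pos))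
      (fun n => (s n.down).1) fun n => (s n.down).2
    obtain ⟨δ, hδ⟩ := exists_isLUB_omegaTwo (T := range s)
      ⟨⟨b, hb⟩, by rintro _ ⟨n, rfl⟩; exact (hsb ⟨n⟩).le⟩
    refine ⟨δ, fun β hβ => ?_, hδ.1 ⟨0, rfl⟩⟩
    obtain ⟨_, ⟨n, rfl⟩, hβn⟩ := (lt_isLUB_iff hδ).1 hβ
    refine (hg (s n) β hβn.le).trans_le ?_
    rw [← hs]
    exact hδ.1 ⟨n + 1, rfl⟩

/-- Closing off a countable set under a countably valued operation on finite sequences. -/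
theorem exists_countable_closed {X : Type*} (c : List X → Set X) (hc : ∀ l, (c l).Countable)
    {S U₀ : Set X} (hS : ∀ l : List X, (∀ x ∈ l, x ∈ S) → c l ⊆ S) (hU₀ : U₀.Countable)
    (hU₀S : U₀ ⊆ S) :
    ∃ U, U₀ ⊆ U ∧ U.Countable ∧ U ⊆ S ∧ ∀ l : List X, (∀ x ∈ l, x ∈ U) → c l ⊆ U := by
  let step : Set X → Set X := fun W => W ∪ ⋃ l : List W, c (l.map Subtype.val)
  let W : ℕ → Set X := fun n => step^[n] U₀
  have hW : ∀ n, W (n + 1) = step (W n) := fun n => Function.iterate_succ_apply' step n U₀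
  have hmono : Monotone W := monotone_nat_of_le_succ fun n => by
    rw [hW]
    exact subset_union_left
  refine ⟨⋃ n, W n, subset_iUnion W 0, ?_, ?_, ?_⟩
  · refine countable_iUnion fun n => ?_
    induction n with
    | zero => exact hU₀
    | succ n ih =>
      rw [hW]
      have : Countable (W n) := ih.to_subtype
      exact ih.union (countable_iUnion fun l => hc _)
  · refine iUnion_subset fun n => ?_
    induction n with
    | zero => exact hU₀S
    | succ n ih =>
      rw [hW]
      refine union_subset ih (iUnion_subset fun l => hS _ fun x hx => ?_)
      obtain ⟨y, -, rfl⟩ := List.mem_map.1 hx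
      exact ih y.2
  · intro l hl
    have hn : ∃ n, ∀ x ∈ l, x ∈ W n := by
      clear hS
      induction l with
      | nil => exact ⟨0, fun x hx => absurd hx (List.not_mem_nil)⟩
      | cons x l ih =>
        obtain ⟨n, hn⟩ := ih fun y hy => hl y (List.mem_cons_of_mem _ hy)
        obtain ⟨m, hm⟩ := mem_iUnion.1 (hl x List.mem_cons_self)
        refine ⟨max n m, fun y hy => ?_⟩
        rcases List.mem_cons.1 hy with rfl | hy
        · exact hmono (le_max_right _ _) hm
        · exact hmono (le_max_left _ _) (hn y hy)
    obtain ⟨n, hn⟩ := hn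
    refine subset_trans ?_ (subset_iUnion W (n + 1))
    rw [hW]
    refine subset_trans ?_ subset_union_right
    have hl' : (l.attach.map fun x => (⟨x.1, hn x.1 x.2⟩ : W n)).map Subtype.val = l := by
      simp
    intro y hy
    exact mem_iUnion.2 ⟨l.attach.map fun x => (⟨x.1, hn x.1 x.2⟩ : W n), by rwa [hl']⟩

/-! ### Player `∃` has no winning strategy -/

theorem EFGame.IsPartialIso.add_iff {A B : Type*} [AddCommGroup A] [AddCommGroup B]
    {π : Set (A × B)} (hπ : EFGame.IsPartialIso groupLang π) {a₀ a₁ a₂ : A} {b₀ b₁ b₂ : B}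
    (h₀ : (a₀, b₀) ∈ π) (h₁ : (a₁, b₁) ∈ π) (h₂ : (a₂, b₂) ∈ π) :
    a₀ + a₁ = a₂ ↔ b₀ + b₁ = b₂ :=
  hπ.2 3 GroupRel.add ![a₀, a₁, a₂] ![b₀, b₁, b₂] fun i => by
    fin_cases i
    exacts [h₀, h₁, h₂]

theorem FreeAbelianGroup.ext_coeff {X : Type*} {a b : FreeAbelianGroup X}
    (h : ∀ i, FreeAbelianGroup.coeff i a = FreeAbelianGroup.coeff i b) : a = b :=
  (FreeAbelianGroup.equivFinsupp X).injective (Finsupp.ext h)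

theorem FreeAbelianGroup.countable_support_subset {X : Type*} (s : Finset X) :
    {a : FreeAbelianGroup X | ∀ i, FreeAbelianGroup.coeff i a ≠ 0 → i ∈ s}.Countable := by
  apply Set.countable_of_injective_of_countable_image
    (f := fun a => fun i : s => FreeAbelianGroup.coeff i.1 a)
  · intro a ha b hb hab
    apply FreeAbelianGroup.ext_coeff
    intro i
    by_cases hi : i ∈ s
    · exact congrFun hab ⟨i, hi⟩
    · rw [not_not.1 (mt (ha i) hi), not_not.1 (mt (hb i) hi)]
  · exact Set.to_countable _

theorem mk_freeAb_omega_one : #(FreeAb (ω_ 1)) = ℵ_ 1 := by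
  rw [(FreeAbelianGroup.equivFinsupp _).toEquiv.cardinal_eq]
  have : Nonempty (Iio (ω_ 1 : Ordinal.{0})) := ⟨⟨0, Ordinal.omega_pos 1⟩⟩
  rw [Cardinal.mk_finsupp_lift_of_infinite']
  simp [Cardinal.mk_Iio_ordinal]

/-- The elements of `F(ω₁)` together with the elements of the stage `δ` of the ladder group. -/
def stageSet (E : Set OmegaTwo) (η : OmegaTwo → ℕ → OmegaTwo) (δ : Ordinal.{0}) :
    Set (FreeAb (ω_ 1) ⊕ ladderGroup E η) :=
  {x | ∀ g, x = Sum.inr g → g.1 ∈ filtrationGroup E η δ}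

section Stage

variable {E : Set OmegaTwo} {η : OmegaTwo → ℕ → OmegaTwo}

theorem inl_mem_stageSet {δ : Ordinal.{0}} (a : FreeAb (ω_ 1)) :
    (Sum.inl a : FreeAb (ω_ 1) ⊕ ladderGroup E η) ∈ stageSet E η δ := by
  rintro g ⟨⟩

theorem inr_mem_stageSet {δ : Ordinal.{0}} {g : ladderGroup E η} :
    (Sum.inr g : FreeAb (ω_ 1) ⊕ ladderGroup E η) ∈ stageSet E η δ ↔
      g.1 ∈ filtrationGroup E η δ := by
  constructor
  · exact fun h => h g rfl
  · rintro h g' ⟨⟩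
    exact h

theorem stageSet_mono {α β : Ordinal.{0}} (h : α ≤ β) : stageSet E η α ⊆ stageSet E η β :=
  fun _ hx g hg => filtrationGroup_mono h (hx g hg)

theorem exists_lt_mem_stageSet {δ : Ordinal.{0}} (hδ : IsSuccLimit δ)
    {x : FreeAb (ω_ 1) ⊕ ladderGroup E η} (hx : x ∈ stageSet E η δ) :
    ∃ β < δ, x ∈ stageSet E η β := by
  rcases x with a | g
  · exact ⟨0, hδ.bot_lt, inl_mem_stageSet a⟩
  · obtain ⟨β, hβ, h⟩ := exists_lt_mem_filtrationGroup hδ (inr_mem_stageSet.1 hx)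
    exact ⟨β, hβ, inr_mem_stageSet.2 h⟩

theorem exists_mem_stageSet (h : IsLadderSystem E η) (hE : IsNonReflecting E)
    (h0 : ∀ δ ∈ E, IsSuccLimit δ.1) (x : FreeAb (ω_ 1) ⊕ ladderGroup E η) :
    ∃ α : OmegaTwo, x ∈ stageSet E η α.1 := by
  rcases x with a | g
  · exact ⟨⟨0, zero_lt_omega_two⟩, inl_mem_stageSet a⟩
  · obtain ⟨α, hα⟩ := exists_lt_omega_two_mem_filtrationGroup
      ((ladderGroup_eq_filtrationGroup h hE h0).le g.2)
    exact ⟨α, inr_mem_stageSet.2 hα⟩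

theorem mk_stageSet_le {δ : Ordinal.{0}} (hδ : δ < ω_ 2) : #(stageSet E η δ) ≤ ℵ_ 1 := by
  have hinf : (ℵ₀ : Cardinal.{1}) ≤ ℵ_ 1 := Cardinal.aleph0_le_aleph 1
  let f : stageSet E η δ → FreeAb (ω_ 1) ⊕ filtrationGroup E η δ := fun x =>
    match x with
    | ⟨Sum.inl a, _⟩ => Sum.inl a
    | ⟨Sum.inr g, hg⟩ => Sum.inr ⟨g.1, inr_mem_stageSet.1 hg⟩
  have hf : Function.Injective f := by
    rintro ⟨a | g, hx⟩ ⟨b | g', hy⟩ hxy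
    · exact Subtype.ext (congrArg Sum.inl (Sum.inl.inj hxy))
    · cases hxy
    · cases hxy
    · refine Subtype.ext (congrArg Sum.inr (Subtype.ext ?_))
      exact congrArg (fun z : filtrationGroup E η δ => z.1) (Sum.inr.inj hxy)
  refine (Cardinal.mk_le_of_injective hf).trans ?_
  rw [Cardinal.mk_sum, Cardinal.lift_id, Cardinal.lift_id, mk_freeAb_omega_one]
  exact Cardinal.add_le_of_le hinf le_rfl (mk_filtrationGroup_le hinf (mk_Iio_le_aleph_one hδ))

/-- Every finitary function on `F(ω₁) ⊔ G` preserves the stage `δ` for some `δ` in a given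
stationary set of limit ordinals. -/
theorem exists_mem_stationary_stageSet_closed (h : IsLadderSystem E η) (hE : IsNonReflecting E)
    (h0 : ∀ δ ∈ E, IsSuccLimit δ.1) (hst : IsStationary E)
    (r : List (FreeAb (ω_ 1) ⊕ ladderGroup E η) → FreeAb (ω_ 1) ⊕ ladderGroup E η) :
    ∃ δ ∈ E, ∀ l : List (FreeAb (ω_ 1) ⊕ ladderGroup E η),
      (∀ x ∈ l, x ∈ stageSet E η δ.1) → r l ∈ stageSet E η δ.1 := by
  choose ρ hρ using exists_mem_stageSet h hE h0
  have hg : ∀ β : OmegaTwo, ∃ γ : OmegaTwo, ∀ l : List (FreeAb (ω_ 1) ⊕ ladderGroup E η),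
      (∀ x ∈ l, x ∈ stageSet E η β.1) → r l ∈ stageSet E η γ.1 := by
    intro β
    have hcard : #(List (stageSet E η β.1)) < ℵ_ 2 :=
      ((Cardinal.mk_list_le_max _).trans (max_le (Cardinal.aleph0_le_aleph 1)
        (mk_stageSet_le β.2))).trans_lt aleph_one_lt_aleph_two
    obtain ⟨γ, hγ, hlt⟩ := exists_bound_lt_omega_two hcard
      (fun l => (ρ (r (l.map Subtype.val))).1) fun l => (ρ _).2
    refine ⟨⟨γ, hγ⟩, fun l hl => ?_⟩
    have := hlt (l.attach.map fun x => (⟨x.1, hl x.1 x.2⟩ : stageSet E η β.1))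
    have hl' : (l.attach.map fun x => (⟨x.1, hl x.1 x.2⟩ : stageSet E η β.1)).map Subtype.val
      = l := by
      rw [List.map_map]
      exact List.attach_map_subtype_val l
    rw [hl'] at this
    exact stageSet_mono this.le (hρ (r l))
  choose g hg using hg
  obtain ⟨δ, hδE, hδ⟩ := hst (isClub_closurePoints g)
  refine ⟨δ, hδE, fun l hl => ?_⟩
  have hlim := h0 δ hδE
  have hβ : ∃ β : OmegaTwo, β < δ ∧ ∀ x ∈ l, x ∈ stageSet E η β.1 := by
    induction l with
    | nil => exact ⟨⟨0, zero_lt_omega_two⟩, hlim.bot_lt, fun x hx => absurd hx List.not_mem_nil⟩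
    | cons x l ih =>
      obtain ⟨β, hβ, hl'⟩ := ih fun y hy => hl y (List.mem_cons_of_mem _ hy)
      obtain ⟨γ, hγ, hx⟩ := exists_lt_mem_stageSet hlim (hl x List.mem_cons_self)
      refine ⟨max β ⟨γ, hγ.trans δ.2⟩, max_lt hβ hγ, fun y hy => ?_⟩
      rcases List.mem_cons.1 hy with rfl | hy
      · exact stageSet_mono (show γ ≤ (max β ⟨γ, hγ.trans δ.2⟩ : OmegaTwo).1 from
          le_max_right β (⟨γ, hγ.trans δ.2⟩ : OmegaTwo)) hx
      · exact stageSet_mono (show β.1 ≤ (max β ⟨γ, hγ.trans δ.2⟩ : OmegaTwo).1 from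
          le_max_left β (⟨γ, hγ.trans δ.2⟩ : OmegaTwo)) (hl' y hy)
  obtain ⟨β, hβδ, hβl⟩ := hβ
  exact stageSet_mono (le_of_lt (hδ β hβδ)) (hg β l hβl)

/-- `∃` has no winning strategy. By stationarity some `δ ∈ E` is closed under a given strategy.
`∀` first plays a countable set `U` closed under the strategy whose part in `F(ω₁)` is the free
factor on countably many generators, and whose part in the group lies below `δ` but contains all
`x_{η_δ(n)}`. Then he plays the tails of `z_δ`. The image of `z_δ` is not in the free factor, but
modulo the free factor it is divisible by all powers of `2`. -/
theorem not_existsWins (h : IsLadderSystem E η) (hE : IsNonReflecting E)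
    (h0 : ∀ δ ∈ E, IsSuccLimit δ.1) (hst : IsStationary E) :
    ¬ EFGame.ExistsWins groupLang (ω_ 1 : Ordinal.{0}) (FreeAb (ω_ 1)) (ladderGroup E η) := by
  intro hwin
  obtain ⟨r, hr⟩ := hwin.exists_isPartialIso (Sum.inl 0)
  obtain ⟨δ, hδE, hδ⟩ := exists_mem_stationary_stageSet_closed h hE h0 hst r
  have hG := ladderGroup_eq_filtrationGroup h hE h0
  let x : ℕ → ladderGroup E η := fun n => ⟨unitVector (η δ n),
    hG.ge (unitVector_mem_filtrationGroup (η δ n).2)⟩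
  let z : ℕ → ladderGroup E η := fun n => ⟨tailVector (η δ) n,
    hG.ge (tailVector_mem_filtrationGroup hδE δ.2 n)⟩
  have hxz : ∀ n, x n + (z (n + 1) + z (n + 1)) = z n := by
    intro n
    apply Subtype.ext
    change unitVector (η δ n) + (tailVector (η δ) (n + 1) + tailVector (η δ) (n + 1)) = _
    rw [← two_smul ℤ]
    exact (tailVector_eq (h δ hδE).1 n).symm
  let c : List (FreeAb (ω_ 1) ⊕ ladderGroup E η) → Set (FreeAb (ω_ 1) ⊕ ladderGroup E η) :=
    fun l => insert (r l) (Sum.inl '' {a | ∀ i, FreeAbelianGroup.coeff i a ≠ 0 →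
      ∃ b, Sum.inl b ∈ l ∧ FreeAbelianGroup.coeff i b ≠ 0})
  have hc : ∀ l, (c l).Countable := by
    classical
    intro l
    refine Set.Countable.insert _ (Set.Countable.image ?_ _)
    refine (FreeAbelianGroup.countable_support_subset
      (l.toFinset.biUnion fun y => y.elim FreeAbelianGroup.support fun _ => ∅)).mono ?_
    intro a ha i hi
    obtain ⟨b, hb, hbi⟩ := ha i hi
    rw [Finset.mem_biUnion]
    exact ⟨Sum.inl b, List.mem_toFinset.2 hb, (FreeAbelianGroup.mem_support_iff i b).2 hbi⟩
  have hcS : ∀ l : List (FreeAb (ω_ 1) ⊕ ladderGroup E η),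
      (∀ y ∈ l, y ∈ stageSet E η δ.1) → c l ⊆ stageSet E η δ.1 := by
    intro l hl
    refine insert_subset (hδ l hl) ?_
    rintro _ ⟨a, -, rfl⟩
    exact inl_mem_stageSet a
  obtain ⟨U, hxU, hUc, hUS, hUcl⟩ := exists_countable_closed c hc hcS
    (U₀ := range fun n => Sum.inr (x n)) (countable_range _) (by
      rintro _ ⟨n, rfl⟩
      exact inr_mem_stageSet.2 (unitVector_mem_filtrationGroup (h.lt hδE n)))
  -- `J`: the generators that occur in the part of `U` in the free group
  let J : Set (Iio (ω_ 1 : Ordinal.{0})) :=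
    {i | ∃ b, Sum.inl b ∈ U ∧ FreeAbelianGroup.coeff i b ≠ 0}
  have hJ : ∀ a : FreeAb (ω_ 1), (∀ i, FreeAbelianGroup.coeff i a ≠ 0 → i ∈ J) →
      Sum.inl a ∈ U := by
    intro a ha
    have : ∀ i : a.support, ∃ b, Sum.inl b ∈ U ∧ FreeAbelianGroup.coeff i.1 b ≠ 0 := fun i =>
      ha i ((FreeAbelianGroup.mem_support_iff _ _).1 i.2)
    choose b hbU hb using this
    refine hUcl (a.support.attach.toList.map fun i => Sum.inl (b i)) ?_
      (Or.inr ⟨a, fun i hi => ?_, rfl⟩)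
    · intro y hy
      obtain ⟨i, -, rfl⟩ := List.mem_map.1 hy
      exact hbU i
    · have hi' := (FreeAbelianGroup.mem_support_iff i a).2 hi
      exact ⟨b ⟨i, hi'⟩, List.mem_map.2 ⟨⟨i, hi'⟩, by simp, rfl⟩, hb ⟨i, hi'⟩⟩
  obtain ⟨π, hπ, hfield, hUU⟩ := hr U
    ((range fun n => Sum.inr (z n)) ∪ range fun n => Sum.inr (z n + z n)) hUc
    ((countable_range _).union (countable_range _)) ⟨_, hxU ⟨0, rfl⟩⟩
    (fun l hl => hUcl l hl (mem_insert _ _))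
  have hk : ∀ n, ∃ a, (a, x n) ∈ π := fun n =>
    EFGame.inr_mem_field.1 (hfield (Or.inl (hxU ⟨n, rfl⟩)))
  have hf : ∀ n, ∃ a, (a, z n) ∈ π := fun n =>
    EFGame.inr_mem_field.1 (hfield (Or.inr (Or.inl ⟨n, rfl⟩)))
  have hw : ∀ n, ∃ a, (a, z n + z n) ∈ π := fun n =>
    EFGame.inr_mem_field.1 (hfield (Or.inr (Or.inr ⟨n, rfl⟩)))
  choose k hk using hk
  choose f hf using hf
  choose w hw using hw
  have hfk : ∀ n, k n + (f (n + 1) + f (n + 1)) = f n := by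
    intro n
    rw [(hπ.add_iff (hf (n + 1)) (hf (n + 1)) (hw (n + 1))).2 rfl]
    exact (hπ.add_iff (hk n) (hw (n + 1)) (hf n)).2 (hxz n)
  have hkJ : ∀ n, ∀ i ∉ J, FreeAbelianGroup.coeff i (k n) = 0 := by
    intro n i hi
    by_contra hne
    exact hi ⟨k n, hUU _ _ (EFGame.matches_inr_inl.2 (hk n)) (hxU ⟨n, rfl⟩), hne⟩
  have hf0 : Sum.inl (f 0) ∉ U := by
    intro hU
    have h1 := inr_mem_stageSet.1 (hUS (hUU _ _ (EFGame.matches_inl_inr.2 (hf 0)) hU))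
    refine ladderVector_notMem_filtrationGroup h hδE (h0 δ hδE) ?_
    rw [← tailVector_zero]
    exact h1
  obtain ⟨i, hi0, hiJ⟩ : ∃ i, FreeAbelianGroup.coeff i (f 0) ≠ 0 ∧ i ∉ J := by
    by_contra! hcon
    exact hf0 (hJ (f 0) hcon)
  have hpow : ∀ n : ℕ, FreeAbelianGroup.coeff i (f 0) = 2 ^ n * FreeAbelianGroup.coeff i (f n) := by
    intro n
    induction n with
    | zero => simp
    | succ n ih =>
      have h2 := congrArg (FreeAbelianGroup.coeff i) (hfk n)
      rw [map_add, map_add, hkJ n i hiJ, zero_add] at h2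
      rw [ih, ← h2]
      ring
  set m := FreeAbelianGroup.coeff i (f 0) with hm
  refine hi0 (Int.eq_zero_of_abs_lt_dvd (m := 2 ^ m.natAbs) ⟨_, hpow m.natAbs⟩ ?_)
  rw [Int.abs_eq_natAbs]
  exact_mod_cast Nat.lt_two_pow_self

end Stage

/-! ### The tree order of a square sequence -/

theorem IsLimitPoint.isSuccLimit {C : Set Ordinal.{0}} {γ : Ordinal.{0}} (h : IsLimitPoint C γ) :
    IsSuccLimit γ := by
  refine ⟨fun hmin => h.1 (le_antisymm (hmin (zero_le (a := γ))) (zero_le (a := γ))), ?_⟩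
  intro β hβ
  obtain ⟨δ, -, h1, h2⟩ := h.2 β hβ.lt
  exact hβ.2 h1 h2

/-- `C` is a `□_{ω₁}`-sequence. -/
def IsSquareSequence (C : Ordinal.{0} → Set Ordinal.{0}) : Prop :=
  ∀ α < ω_ 2, IsSuccLimit α →
    (C α ⊆ Iio α ∧ IsClub ((↑) ⁻¹' C α : Set (Iio α))) ∧
    (α.cof = ℵ₀ → #(C α) = ℵ₀) ∧
    ∀ γ < α, IsLimitPoint (C α) γ → C γ = C α ∩ Iio γ

/-- `γ` precedes `δ` in the tree order of `C`: it is a limit point of `C δ` below `δ`. -/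
def TreeLT (C : Ordinal.{0} → Set Ordinal.{0}) (γ δ : Ordinal.{0}) : Prop :=
  IsSuccLimit δ ∧ δ < ω_ 2 ∧ γ < δ ∧ IsLimitPoint (C δ) γ

/-- The height of `γ` in the tree order of `C`. -/
noncomputable def treeRank (C : Ordinal.{0} → Set Ordinal.{0}) (γ : Ordinal.{0}) : Ordinal.{0} :=
  ⨆ β : {β : Iio γ // TreeLT C β γ}, (treeRank C β.1.1 + 1)
termination_by γ
decreasing_by exact β.1.2

section Square

variable {C : Ordinal.{0} → Set Ordinal.{0}}

theorem TreeLT.lt {γ δ : Ordinal.{0}} (h : TreeLT C γ δ) : γ < δ := h.2.2.1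

theorem TreeLT.isSuccLimit {γ δ : Ordinal.{0}} (h : TreeLT C γ δ) : IsSuccLimit γ :=
  h.2.2.2.isSuccLimit

theorem TreeLT.treeRank_lt {γ δ : Ordinal.{0}} (h : TreeLT C γ δ) :
    treeRank C γ < treeRank C δ := by
  rw [treeRank.eq_1 C δ]
  exact Ordinal.lt_iSup_add_one (f := fun β : {β : Iio δ // TreeLT C β δ} => treeRank C β.1.1)
    ⟨⟨γ, h.lt⟩, h⟩

theorem exists_le_treeRank_of_lt {i γ : Ordinal.{0}} (h : i < treeRank C γ) :
    ∃ β, TreeLT C β γ ∧ i ≤ treeRank C β := by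
  rw [treeRank, Ordinal.lt_iSup_iff] at h
  obtain ⟨β, hβ⟩ := h
  exact ⟨β.1.1, β.2, Order.lt_add_one_iff.1 hβ⟩

theorem treeRank_lt_omega_one_of_countable {γ : Ordinal.{0}} (hγ : {β | TreeLT C β γ}.Countable)
    (h : ∀ β, TreeLT C β γ → treeRank C β < ω_ 1) : treeRank C γ < ω_ 1 := by
  rw [treeRank]
  have : Countable {β : Iio γ // TreeLT C β γ} := by
    have := hγ.to_subtype
    exact Function.Injective.countable (f := fun β : {β : Iio γ // TreeLT C β γ} =>
      (⟨β.1.1, β.2⟩ : {β | TreeLT C β γ})) fun a b hab => Subtype.ext (Subtype.ext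
        (congrArg (fun z : {β | TreeLT C β γ} => z.1) hab))
  refine Ordinal.iSup_lt_omega_one fun β => ?_
  exact (Cardinal.isSuccLimit_omega 1).add_one_lt (h _ β.2)

namespace IsSquareSequence

theorem mem_of_treeLT (hC : IsSquareSequence C) {γ δ : Ordinal.{0}} (h : TreeLT C γ δ) :
    γ ∈ C δ := by
  obtain ⟨hδ, hδ2, hlt, hlim⟩ := h
  obtain ⟨⟨-, hclub⟩, -, -⟩ := hC δ hδ2 hδ
  have hγ0 : (0 : Ordinal.{0}) < γ := hlim.isSuccLimit.bot_lt
  obtain ⟨c, hc, -, hcγ⟩ := hlim.2 0 hγ0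
  refine hclub.isLUB_mem (x := ⟨γ, hlt⟩) (t := {x | x.1 ∈ C δ ∧ x.1 < γ}) (fun x hx => hx.1)
    ⟨⟨c, hcγ.trans hlt⟩, hc, hcγ⟩ ⟨fun x hx => le_of_lt hx.2, fun u hu => ?_⟩
  by_contra hcon
  obtain ⟨d, hd, h1, h2⟩ := hlim.2 u.1 (not_le.1 hcon)
  exact absurd (hu (a := ⟨d, h2.trans hlt⟩) ⟨hd, h2⟩) (not_le.2 h1)

theorem eq_inter_of_treeLT (hC : IsSquareSequence C) {γ δ : Ordinal.{0}} (h : TreeLT C γ δ) :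
    C γ = C δ ∩ Iio γ :=
  (hC δ h.2.1 h.1).2.2 γ h.2.2.1 h.2.2.2

theorem exists_gt_mem (hC : IsSquareSequence C) {δ x : Ordinal.{0}} (hδ : IsSuccLimit δ)
    (hδ2 : δ < ω_ 2) (hx : x < δ) : ∃ c ∈ C δ, x < c := by
  obtain ⟨⟨-, hclub⟩, -, -⟩ := hC δ hδ2 hδ
  obtain ⟨c, hc, hle⟩ := hclub.isCofinal ⟨succ x, hδ.succ_lt hx⟩
  exact ⟨c.1, hc, succ_le_iff.1 (show succ x ≤ c.1 from hle)⟩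

theorem treeLT_trans (hC : IsSquareSequence C) {β γ δ : Ordinal.{0}} (h : TreeLT C β γ)
    (h' : TreeLT C γ δ) : TreeLT C β δ := by
  refine ⟨h'.1, h'.2.1, h.lt.trans h'.lt, h.2.2.2.1, fun x hx => ?_⟩
  obtain ⟨c, hc, h1, h2⟩ := h.2.2.2.2 x hx
  rw [hC.eq_inter_of_treeLT h'] at hc
  exact ⟨c, hc.1, h1, h2⟩

theorem treeLT_of_lt (hC : IsSquareSequence C) {β γ δ : Ordinal.{0}} (h : TreeLT C β δ)
    (h' : TreeLT C γ δ) (hlt : β < γ) : TreeLT C β γ := by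
  refine ⟨h'.isSuccLimit, h'.lt.trans h'.2.1, hlt, h.2.2.2.1, fun x hx => ?_⟩
  obtain ⟨c, hc, h1, h2⟩ := h.2.2.2.2 x hx
  rw [hC.eq_inter_of_treeLT h']
  exact ⟨c, ⟨hc, h2.trans hlt⟩, h1, h2⟩

theorem treeLT_of_forall_exists {γ δ : Ordinal.{0}} (hγ : γ ≠ 0)
    (hlt : γ < δ) (h : ∀ x < γ, ∃ β, TreeLT C β δ ∧ x < β ∧ β < γ) : TreeLT C γ δ := by
  obtain ⟨β, hβ, -⟩ := h 0 (pos_iff_ne_zero.2 hγ)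
  refine ⟨hβ.1, hβ.2.1, hlt, hγ, fun x hx => ?_⟩
  obtain ⟨β', hβ', h1, h2⟩ := h x hx
  obtain ⟨c, hc, h3, h4⟩ := hβ'.2.2.2.2 x h1
  exact ⟨c, hc, h3, h4.trans h2⟩

theorem countable_treeLT_of_cof_eq_aleph0 (hC : IsSquareSequence C) {δ : Ordinal.{0}}
    (hcof : δ.cof = ℵ₀) : {β | TreeLT C β δ}.Countable := by
  rcases eq_empty_or_nonempty {β | TreeLT C β δ} with he | ⟨β, hβ⟩
  · rw [he]
    exact countable_empty
  · have hc : (C δ).Countable := by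
      rw [← Cardinal.le_aleph0_iff_set_countable]
      exact ((hC δ hβ.2.1 hβ.1).2.1 hcof).le
    exact hc.mono fun γ hγ => hC.mem_of_treeLT hγ

theorem exists_gt_treeLT (hC : IsSquareSequence C) {δ x : Ordinal.{0}} (hδ2 : δ < ω_ 2)
    (hcof : δ.cof = ℵ_ 1) (hx : x < δ) : ∃ β, TreeLT C β δ ∧ x < β ∧ β.cof = ℵ₀ := by
  have hδ : IsSuccLimit δ := by
    rw [← Ordinal.one_lt_cof_iff, hcof]
    exact Cardinal.one_lt_aleph0.trans_le (Cardinal.aleph0_le_aleph 1)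
  have hnext : ∀ y : Iio δ, ∃ c : Iio δ, c.1 ∈ C δ ∧ y < c := by
    intro y
    obtain ⟨c, hc, hyc⟩ := hC.exists_gt_mem hδ hδ2 y.2
    exact ⟨⟨c, (hC δ hδ2 hδ).1.1 hc⟩, hc, hyc⟩
  choose f hfC hf using hnext
  let s : ℕ → Ordinal.{0} := fun n => (f^[n + 1] ⟨x, hx⟩).1
  have hs : ∀ n, s (n + 1) = (f (f^[n + 1] ⟨x, hx⟩)).1 := fun n => by
    simp only [s, Function.iterate_succ_apply' f (n + 1)]
  have hmono : StrictMono s := strictMono_nat_of_lt_succ fun n => by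
    rw [hs]
    exact hf (f^[n + 1] ⟨x, hx⟩)
  have hsC : ∀ n, s n ∈ C δ := fun n => by
    simp only [s, Function.iterate_succ_apply' f n]
    exact hfC _
  have hlt : ∀ n, s n < ⨆ n, s n := fun n =>
    (hmono n.lt_succ_self).trans_le (Ordinal.le_iSup s (n + 1))
  have hsup : ⨆ n, s n < δ := by
    apply Ordinal.lift_iSup_lt_of_lt_cof
    · simp only [Cardinal.mk_nat, Cardinal.lift_aleph0, Ordinal.lift_uzero, hcof]
      exact Cardinal.aleph0_lt_aleph.2 one_pos
    · exact fun n => (f^[n + 1] ⟨x, hx⟩).2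
  refine ⟨⨆ n, s n, ⟨hδ, hδ2, hsup, ?_, fun y hy => ?_⟩, ?_, ?_⟩
  · exact (pos_of_gt (hlt 0)).ne'
  · obtain ⟨n, hn⟩ := Ordinal.lt_iSup_iff.1 hy
    exact ⟨s n, hsC n, hn, hlt n⟩
  · exact (show x < s 0 from hf ⟨x, hx⟩).trans (hlt 0)
  · rw [Ordinal.cof_iSup hmono, Order.cof_nat]

theorem countable_treeLT_of_treeLT (hC : IsSquareSequence C) {β δ : Ordinal.{0}}
    (hcof : δ.cof = ℵ_ 1) (h : TreeLT C β δ) : {α | TreeLT C α β}.Countable := by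
  obtain ⟨γ, hγ, hlt, hγcof⟩ := hC.exists_gt_treeLT h.2.1 hcof h.lt
  exact (hC.countable_treeLT_of_cof_eq_aleph0 hγcof).mono fun α hα =>
    hC.treeLT_trans hα (hC.treeLT_of_lt h hγ hlt)

theorem treeRank_lt_omega_one (hC : IsSquareSequence C) {γ : Ordinal.{0}}
    (hγ : {β | TreeLT C β γ}.Countable) : treeRank C γ < ω_ 1 := by
  induction γ using WellFoundedLT.induction with
  | ind γ ih =>
  refine treeRank_lt_omega_one_of_countable hγ fun β hβ => ih β hβ.lt ?_
  exact hγ.mono fun α hα => hC.treeLT_trans hα hβ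

/-- Below a point of cofinality `ω₁` the tree has height `ω₁`: its predecessors are cofinal, hence
uncountably many, and they have distinct heights. -/
theorem exists_lt_treeRank (hC : IsSquareSequence C) {δ i : Ordinal.{0}} (hδ2 : δ < ω_ 2)
    (hcof : δ.cof = ℵ_ 1) (hi : i < ω_ 1) : ∃ β, TreeLT C β δ ∧ i < treeRank C β := by
  by_contra! hcon
  have hcount : {β | TreeLT C β δ}.Countable := by
    have hI : (Iio (succ i)).Countable :=
      EFGame.countable_Iio_of_lt_omega_one ((Cardinal.isSuccLimit_omega 1).succ_lt hi)
    refine Set.MapsTo.countable_of_injOn (f := treeRank C) (t := Iio (succ i))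
      (fun β hβ => lt_succ_iff.2 (hcon β hβ)) (fun β hβ γ hγ he => ?_) hI
    rcases lt_trichotomy β γ with h | h | h
    · exact absurd he (hC.treeLT_of_lt hβ hγ h).treeRank_lt.ne
    · exact h
    · exact absurd he (hC.treeLT_of_lt hγ hβ h).treeRank_lt.ne'
  have hsup : sSup {β | TreeLT C β δ} < δ := by
    apply Ordinal.sSup_lt_of_lt_cof
    · rw [← Ordinal.lift_cof, hcof]
      refine (Cardinal.le_aleph0_iff_set_countable.2 hcount).trans_lt ?_
      simp
    · exact fun β hβ => hβ.lt
  obtain ⟨β, hβ, hlt, -⟩ := hC.exists_gt_treeLT hδ2 hcof hsup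
  exact absurd (le_csSup ⟨δ, fun γ hγ => hγ.lt.le⟩ hβ) (not_le.2 hlt)

end IsSquareSequence

end Square

/-! ### The stationary set -/

/-- A club of `ω₂` contains points of cofinality `cof a`, for every limit ordinal `a < ω₂`. -/
theorem IsClub.exists_cof_eq {K : Set OmegaTwo} (hK : IsClub K) {a : Ordinal.{0}}
    (ha : IsSuccLimit a) (ha1 : a < ω_ 2) : ∃ δ ∈ K, δ.1.cof = a.cof := by
  have hnext : ∀ (i : Iio a) (q : ∀ j : Iio a, j < i → OmegaTwo),
      ∃ x ∈ K, ∀ j hj, q j hj < x := by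
    intro i q
    have hcard : #{j // j < i} < ℵ_ 2 := by
      refine ((Cardinal.mk_subtype_le (fun j : Iio a => j < i)).trans
        (mk_Iio_le_aleph_one ha1)).trans_lt aleph_one_lt_aleph_two
    obtain ⟨b, hb, hqb⟩ := exists_bound_lt_omega_two hcard (fun j => (q j.1 j.2).1)
      fun j => (q j.1 j.2).2
    obtain ⟨x, hx, hbx⟩ := hK.isCofinal ⟨b, hb⟩
    exact ⟨x, hx, fun j hj => (show q j hj < ⟨b, hb⟩ from hqb ⟨j, hj⟩).trans_le hbx⟩
  choose F hFK hF using hnext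
  let f : Iio a → OmegaTwo := (wellFounded_lt (α := Iio a)).fix F
  have hf : ∀ i, f i = F i fun j _ => f j := fun i => WellFounded.fix_eq _ F i
  have hmono : StrictMono f := fun j i hji => by
    rw [hf i]
    exact hF i _ j hji
  have hfK : ∀ i, f i ∈ K := fun i => by
    rw [hf i]
    exact hFK _ _
  obtain ⟨b, hb, hfb⟩ := exists_bound_lt_omega_two
    ((mk_Iio_le_aleph_one ha1).trans_lt aleph_one_lt_aleph_two) (fun i => (f i).1) fun i => (f i).2
  obtain ⟨δ, hδ⟩ := exists_isLUB_omegaTwo (T := range f)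
    ⟨⟨b, hb⟩, by rintro _ ⟨i, rfl⟩; exact (hfb i).le⟩
  have hrange : range f ⊆ K := by
    rintro _ ⟨i, rfl⟩
    exact hfK i
  have hne : (range f).Nonempty := ⟨f ⟨0, ha.bot_lt⟩, mem_range_self _⟩
  refine ⟨δ, hK.isLUB_mem hrange hne hδ, ?_⟩
  have hsup : δ.1 = ⨆ i, (f i).1 := by
    apply le_antisymm
    · have hs : ⨆ i, (f i).1 ≤ b := Ordinal.iSup_le fun i => (hfb i).le
      have hub : (⟨⨆ i, (f i).1, hs.trans_lt hb⟩ : OmegaTwo) ∈ upperBounds (range f) := by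
        rintro _ ⟨i, rfl⟩
        exact Ordinal.le_iSup (fun i => (f i).1) i
      exact hδ.2 hub
    · exact Ordinal.iSup_le fun i => hδ.1 ⟨i, rfl⟩
  rw [hsup]
  exact Ordinal.cof_iSup_Iio (f := fun i => (f i).1) (fun j i h => hmono h) ha.isSuccPrelimit

theorem isSuccLimit_of_cof_eq_aleph0 {δ : Ordinal.{0}} (h : δ.cof = ℵ₀) : IsSuccLimit δ := by
  rw [← Ordinal.one_lt_cof_iff, h]
  exact Cardinal.one_lt_aleph0

theorem omega_one_lt_omega_two : (ω_ 1 : Ordinal.{0}) < ω_ 2 :=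
  Ordinal.omega_lt_omega.2 one_lt_two

theorem omega_one_mul_lt {γ : Ordinal.{0}} (h : γ < ω_ 2) : ω_ 1 * γ < ω_ 2 :=
  Ordinal.isPrincipal_mul_omega 2 omega_one_lt_omega_two h

/-- The points `γ` of cofinality `ω` and of height `ξ` in the tree of `C`. Only fixed points of
`γ ↦ ω₁ γ` are kept, so that `ω₁ γ` belongs to the set only if `γ` does. -/
def levelSet (C : Ordinal.{0} → Set Ordinal.{0}) (ξ : Ordinal.{0}) : Set OmegaTwo :=
  {γ | γ.1.cof = ℵ₀ ∧ ω_ 1 * γ.1 = γ.1 ∧ treeRank C γ.1 = ξ}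

theorem isStationary_cof_aleph0_fixedPoints :
    IsStationary {γ : OmegaTwo | γ.1.cof = ℵ₀ ∧ ω_ 1 * γ.1 = γ.1} := by
  intro K hK
  have hclub := hK.inter cof_omegaTwo_ne_aleph0
    (isClub_closurePoints fun β => ⟨ω_ 1 * β.1, omega_one_mul_lt β.2⟩)
  obtain ⟨δ, ⟨hδK, hδ⟩, hcof⟩ := hclub.exists_cof_eq Ordinal.isSuccLimit_omega0
    (Ordinal.omega0_lt_omega_one.trans omega_one_lt_omega_two)
  rw [Ordinal.cof_omega0] at hcof
  refine ⟨δ, ⟨hcof, le_antisymm ?_ ?_⟩, hδK⟩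
  · rw [Ordinal.mul_le_iff_of_isSuccLimit (isSuccLimit_of_cof_eq_aleph0 hcof)]
    intro β hβ
    exact le_of_lt (hδ ⟨β, hβ.trans δ.2⟩ hβ)
  · exact Ordinal.le_mul_right _ (Ordinal.omega_pos 1)

section Level

variable {C : Ordinal.{0} → Set Ordinal.{0}}

/-- Pressing down in its simplest form: the heights of points of cofinality `ω` are countable
ordinals, so one of the levels is stationary. -/
theorem IsSquareSequence.exists_isStationary_levelSet (hC : IsSquareSequence C) :
    ∃ ξ, IsStationary (levelSet C ξ) := by
  have hst := isStationary_cof_aleph0_fixedPoints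
  have hU : {γ : OmegaTwo | γ.1.cof = ℵ₀ ∧ ω_ 1 * γ.1 = γ.1} ⊆
      ⋃ ξ : Iio (ω_ 1 : Ordinal.{0}), levelSet C ξ := by
    intro γ hγ
    exact mem_iUnion.2 ⟨⟨treeRank C γ.1,
      hC.treeRank_lt_omega_one (hC.countable_treeLT_of_cof_eq_aleph0 hγ.1)⟩, hγ.1, hγ.2, rfl⟩
  have hst' := hst.mono hU
  rw [isStationary_iUnion_iff cof_omegaTwo_ne_aleph0] at hst'
  · obtain ⟨ξ, hξ⟩ := hst'
    exact ⟨ξ, hξ⟩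
  · rw [cof_omegaTwo, Cardinal.lift_id, Cardinal.lift_id]
    exact (mk_Iio_le_aleph_one omega_one_lt_omega_two).trans_lt aleph_one_lt_aleph_two

theorem isSuccLimit_val {γ : OmegaTwo} (h : IsSuccLimit γ) : IsSuccLimit γ.1 := by
  refine ⟨fun hmin => h.1 fun x hx => hmin (show x.1 ≤ γ.1 from hx), fun β hβ => ?_⟩
  exact h.2 ⟨β, hβ.lt.trans γ.2⟩ ⟨hβ.lt, fun x hx hx' => hβ.2 hx hx'⟩

/-- Below a limit `γ`, the successors of elements of `C γ` and the limit points of `C γ` form a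
club, which meets a level of the tree in at most one point. -/
theorem IsSquareSequence.isNonReflecting_levelSet (hC : IsSquareSequence C) (ξ : Ordinal.{0}) :
    IsNonReflecting (levelSet C ξ) := by
  intro γ hγ
  have hlim := isSuccLimit_val hγ
  have hmin : ∀ {ε ε' : Ordinal.{0}}, TreeLT C ε γ.1 → TreeLT C ε' γ.1 → treeRank C ε = ξ →
      treeRank C ε' = ξ → ε = ε' := by
    intro ε ε' h h' hr hr'
    rcases lt_trichotomy ε ε' with hlt | he | hlt
    · exact absurd (hr.trans hr'.symm) (hC.treeLT_of_lt h h' hlt).treeRank_lt.ne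
    · exact he
    · exact absurd (hr'.trans hr.symm) (hC.treeLT_of_lt h' h hlt).treeRank_lt.ne
  let D : Set (Iio γ) := {x | ((∃ c ∈ C γ.1, x.1.1 = succ c) ∨ TreeLT C x.1.1 γ.1) ∧
    ∀ ε, TreeLT C ε γ.1 → treeRank C ε = ξ → ε < x.1.1}
  refine not_isStationary_iff.2 ⟨D, ⟨?_, ?_⟩, ?_⟩
  · intro t ht htne _ a ha
    by_cases hat : a ∈ t
    · exact ht hat
    have hex : ∀ β : Iio γ, β < a → ∃ x ∈ t, β < x ∧ x < a := by
      intro β hβ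
      obtain ⟨x, hx, hβx⟩ := (lt_isLUB_iff ha).1 hβ
      exact ⟨x, hx, hβx, lt_of_le_of_ne (ha.1 hx) fun he => hat (he ▸ hx)⟩
    obtain ⟨x₀, hx₀⟩ := htne
    have hx₀a : x₀ < a := lt_of_le_of_ne (ha.1 hx₀) fun he => hat (he ▸ hx₀)
    refine ⟨Or.inr ⟨hlim, γ.2, a.2, ?_, fun β hβ => ?_⟩, fun ε h1 h2 =>
      ((ht hx₀).2 ε h1 h2).trans hx₀a⟩
    · exact (pos_of_gt (show x₀.1.1 < a.1.1 from hx₀a)).ne'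
    · have hβγ : β < γ.1 := hβ.trans a.2
      obtain ⟨x, hx, hβx, hxa⟩ := hex ⟨⟨β, hβγ.trans γ.2⟩, hβγ⟩ hβ
      obtain ⟨y, hy, hxy, hya⟩ := hex x hxa
      have hβx' : β < x.1.1 := hβx
      have hxy' : x.1.1 < y.1.1 := hxy
      have hya' : y.1.1 < a.1.1 := hya
      rcases (ht hy).1 with ⟨c, hc, hyc⟩ | hlt
      · rw [hyc] at hxy' hya'
        exact ⟨c, hc, hβx'.trans_le (lt_succ_iff.1 hxy'), (lt_succ c).trans hya'⟩
      · obtain ⟨c, hc, h1, h2⟩ := hlt.2.2.2.2 x.1.1 hxy'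
        exact ⟨c, hc, hβx'.trans h1, h2.trans hya'⟩
  · intro a
    have hb : ∃ b < γ.1, a.1.1 ≤ b ∧ ∀ ε, TreeLT C ε γ.1 → treeRank C ε = ξ → ε ≤ b := by
      by_cases hε : ∃ ε, TreeLT C ε γ.1 ∧ treeRank C ε = ξ
      · obtain ⟨ε, h1, h2⟩ := hε
        exact ⟨max a.1.1 ε, max_lt a.2 h1.lt, le_max_left _ _, fun ε' h1' h2' =>
          (hmin h1' h1 h2' h2).le.trans (le_max_right _ _)⟩
      · exact ⟨a.1.1, a.2, le_rfl, fun ε h1 h2 => absurd ⟨ε, h1, h2⟩ hε⟩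
    obtain ⟨b, hbγ, hab, hb⟩ := hb
    obtain ⟨c, hc, hbc⟩ := hC.exists_gt_mem hlim γ.2 hbγ
    have hcγ : c < γ.1 := (hC γ.1 γ.2 hlim).1.1 hc
    have hsγ := hlim.succ_lt hcγ
    refine ⟨⟨⟨succ c, hsγ.trans γ.2⟩, hsγ⟩, ⟨Or.inl ⟨c, hc, rfl⟩, fun ε h1 h2 =>
      (hb ε h1 h2).trans_lt (hbc.trans (lt_succ c))⟩, ?_⟩
    exact hab.trans (hbc.trans (lt_succ c)).le
  · rw [Set.disjoint_left]
    rintro x ⟨hcof, -, hrank⟩ ⟨hx | hx, hgt⟩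
    · obtain ⟨c, -, hc⟩ := hx
      have := isSuccLimit_of_cof_eq_aleph0 hcof
      rw [hc] at this
      exact not_isSuccLimit_succ c this
    · exact lt_irrefl _ (hgt _ hx hrank)

/-- Points of cofinality `ω` have ladders. -/
theorem exists_isLadderSystem {E : Set OmegaTwo} (hE : ∀ δ ∈ E, δ.1.cof = ℵ₀) :
    ∃ η, IsLadderSystem E η := by
  have key : ∀ δ : OmegaTwo, ∃ e : ℕ → OmegaTwo,
      δ ∈ E → StrictMono e ∧ IsLUB (range e) δ := by
    intro δ
    by_cases hδ : δ ∈ E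
    swap
    · exact ⟨fun _ => δ, fun h => absurd h hδ⟩
    have hcof := hE δ hδ
    have hlim := isSuccLimit_of_cof_eq_aleph0 hcof
    obtain ⟨s, hs, hsc⟩ := Order.exists_cof_eq (Iio δ.1)
    rw [Ordinal.cof_Iio, ← Ordinal.lift_cof, hcof, Cardinal.lift_aleph0] at hsc
    have hne : s.Nonempty := by
      have : Nonempty (Iio δ.1) := ⟨⟨0, hlim.bot_lt⟩⟩
      exact hs.nonempty
    obtain ⟨g, hg⟩ := (Cardinal.le_aleph0_iff_set_countable.1 hsc.le).exists_eq_range hne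
    -- dominate the enumeration `g` of a cofinal set by a strictly increasing sequence
    let e : ℕ → Iio δ.1 := fun n => Nat.rec (g 0)
      (fun n x => ⟨succ (max x.1 (g (n + 1)).1), hlim.succ_lt (max_lt x.2 (g (n + 1)).2)⟩) n
    have he : ∀ n, (e (n + 1)).1 = succ (max (e n).1 (g (n + 1)).1) := fun n => rfl
    have hge : ∀ n, (g n).1 ≤ (e n).1 := by
      intro n
      cases n with
      | zero => exact le_rfl
      | succ n =>
        rw [he]
        exact (le_max_right _ _).trans (le_succ _)
    refine ⟨fun n => ⟨(e n).1, (mem_Iio.1 (e n).2).trans δ.2⟩, fun _ => ⟨?_, ?_, ?_⟩⟩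
    · refine strictMono_nat_of_lt_succ fun n => ?_
      change (e n).1 < (e (n + 1)).1
      rw [he]
      exact lt_succ_iff.2 (le_max_left _ _)
    · rintro _ ⟨n, rfl⟩
      exact le_of_lt (e n).2
    · intro u hu
      by_contra hcon
      have hlt : u.1 < δ.1 := not_le.1 hcon
      obtain ⟨x, hx, hux⟩ := hs ⟨succ u.1, hlim.succ_lt hlt⟩
      rw [hg] at hx
      obtain ⟨n, rfl⟩ := hx
      have h1 : (e n).1 ≤ u.1 := hu ⟨n, rfl⟩
      have h2 : succ u.1 ≤ (g n).1 := hux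
      exact absurd (h2.trans ((hge n).trans h1)) (not_le.2 (lt_succ _))
  choose η hη using key
  exact ⟨η, fun δ hδ => hη δ hδ⟩

end Level

/-! ### Blocks between consecutive points of a branch -/

section Branch

variable {C : Ordinal.{0} → Set Ordinal.{0}} {ξ : Ordinal.{0}}

/-- `γ` lies on the branch of `δ`: it precedes `δ` in the tree order and its height exceeds `ξ`,
so that no point of the branch is in the level `ξ`. -/
def BranchLT (C : Ordinal.{0} → Set Ordinal.{0}) (ξ γ δ : Ordinal.{0}) : Prop :=
  TreeLT C γ δ ∧ ξ < treeRank C γ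

/-- The points whose branches are used: those of height greater than `ξ` and at most `ω₁`. -/
def IsBranchPoint (C : Ordinal.{0} → Set Ordinal.{0}) (ξ δ : Ordinal.{0}) : Prop :=
  IsSuccLimit δ ∧ δ < ω_ 2 ∧ ξ < treeRank C δ ∧ ∀ β, TreeLT C β δ → treeRank C β < ω_ 1

/-- The supremum of the branch of `γ`; it is `0` if the branch is empty. -/
noncomputable def branchSup (C : Ordinal.{0} → Set Ordinal.{0}) (ξ γ : Ordinal.{0}) :
    Ordinal.{0} :=
  sSup {β | BranchLT C ξ β γ}

/-- The pair `β < γ` bounds a block: `β` is on the branch of `γ` or `β = 0`. -/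
def IsBlock (C : Ordinal.{0} → Set Ordinal.{0}) (ξ β γ : Ordinal.{0}) : Prop :=
  IsBranchPoint C ξ γ ∧ (β = 0 ∨ BranchLT C ξ β γ)

theorem treeRank_zero : treeRank C 0 = 0 := by
  by_contra h
  obtain ⟨β, hβ, -⟩ := exists_le_treeRank_of_lt (pos_iff_ne_zero.2 h)
  exact absurd hβ.lt not_lt_zero

theorem IsBranchPoint.of_branchLT (hC : IsSquareSequence C) {γ δ : Ordinal.{0}}
    (hδ : IsBranchPoint C ξ δ) (h : BranchLT C ξ γ δ) : IsBranchPoint C ξ γ :=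
  ⟨h.1.isSuccLimit, h.1.lt.trans hδ.2.1, h.2, fun β hβ =>
    hδ.2.2.2 β (hC.treeLT_trans hβ h.1)⟩

theorem BranchLT.trans (hC : IsSquareSequence C) {β γ δ : Ordinal.{0}} (h : BranchLT C ξ β γ)
    (h' : BranchLT C ξ γ δ) : BranchLT C ξ β δ :=
  ⟨hC.treeLT_trans h.1 h'.1, h.2⟩

theorem BranchLT.of_lt (hC : IsSquareSequence C) {β γ δ : Ordinal.{0}} (h : BranchLT C ξ β δ)
    (h' : BranchLT C ξ γ δ) (hlt : β < γ) : BranchLT C ξ β γ :=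
  ⟨hC.treeLT_of_lt h.1 h'.1 hlt, h.2⟩

theorem BranchLT.le_branchSup {β γ : Ordinal.{0}} (h : BranchLT C ξ β γ) :
    β ≤ branchSup C ξ γ :=
  le_csSup ⟨γ, fun _ hx => hx.1.lt.le⟩ h

/-- A branch that is not cofinal is empty or has a last point, by closedness. -/
theorem isBlock_branchSup (hC : IsSquareSequence C) {γ : Ordinal.{0}}
    (hγ : IsBranchPoint C ξ γ) (hnc : ¬ ∀ x < γ, ∃ β, BranchLT C ξ β γ ∧ x < β) :
    IsBlock C ξ (branchSup C ξ γ) γ := by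
  refine ⟨hγ, ?_⟩
  push Not at hnc
  obtain ⟨x, hx, hbd⟩ := hnc
  rcases eq_empty_or_nonempty {β | BranchLT C ξ β γ} with he | ⟨β₀, hβ₀⟩
  · left
    rw [branchSup, he, csSup_empty]
    rfl
  right
  by_contra hp
  have hlt : branchSup C ξ γ < γ := (csSup_le ⟨β₀, hβ₀⟩ fun β hβ => hbd β hβ).trans_lt hx
  have hne : ∀ β, BranchLT C ξ β γ → β < branchSup C ξ γ := fun β hβ =>
    lt_of_le_of_ne hβ.le_branchSup fun he => hp (he ▸ hβ)
  have htree : TreeLT C (branchSup C ξ γ) γ := by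
    refine IsSquareSequence.treeLT_of_forall_exists ?_ hlt fun y hy => ?_
    · exact (pos_of_gt (hne β₀ hβ₀)).ne'
    · obtain ⟨β, hβ, hyβ⟩ := exists_lt_of_lt_csSup ⟨β₀, hβ₀⟩ hy
      exact ⟨β, hβ.1, hyβ, hne β hβ⟩
  exact hp ⟨htree, hβ₀.2.trans (hC.treeLT_of_lt hβ₀.1 htree (hne β₀ hβ₀)).treeRank_lt⟩

theorem IsBlock.lt {β γ : Ordinal.{0}} (h : IsBlock C ξ β γ) : β < γ := by
  rcases h.2 with rfl | h'
  · exact h.1.1.bot_lt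
  · exact h'.1.lt

theorem IsBlock.treeRank_lt {β γ : Ordinal.{0}} (h : IsBlock C ξ β γ) :
    treeRank C β < treeRank C γ := by
  rcases h.2 with rfl | h'
  · rw [treeRank_zero]
    exact pos_of_gt h.1.2.2.1
  · exact h'.1.treeRank_lt

theorem IsBlock.treeRank_lt_omega_one {β γ : Ordinal.{0}} (h : IsBlock C ξ β γ) :
    treeRank C β < ω_ 1 := by
  rcases h.2 with rfl | h'
  · rw [treeRank_zero]
    exact Ordinal.omega_pos 1
  · exact h.1.2.2.2 β h'.1

theorem omega_one_mul_lt_mul {β γ : Ordinal.{0}} (h : β < γ) : ω_ 1 * β < ω_ 1 * γ :=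
  (mul_lt_mul_iff_right₀ (Ordinal.omega_pos 1)).2 h

theorem omega_one_mul_le_mul {β γ : Ordinal.{0}} (h : β ≤ γ) : ω_ 1 * β ≤ ω_ 1 * γ :=
  mul_le_mul_right h _

/-- The lower end of a block is not in the level `ξ`. -/
theorem IsBlock.notMem_levelSet {β γ : Ordinal.{0}} (h : IsBlock C ξ β γ)
    (hβ : ω_ 1 * β < ω_ 2) : (⟨ω_ 1 * β, hβ⟩ : OmegaTwo) ∉ levelSet C ξ := by
  rintro ⟨hcof, hfix, hrank⟩
  have hfix' : ω_ 1 * (ω_ 1 * β) = ω_ 1 * β := hfix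
  have hβ' : ω_ 1 * β = β := by
    rcases lt_trichotomy (ω_ 1 * β) β with hlt | he | hlt
    · exact absurd hfix' (omega_one_mul_lt_mul hlt).ne
    · exact he
    · exact absurd hfix' (omega_one_mul_lt_mul hlt).ne'
  simp only [hβ'] at hcof hrank
  rcases h.2 with rfl | h'
  · rw [Ordinal.cof_zero] at hcof
    exact Cardinal.aleph0_ne_zero hcof.symm
  · exact absurd hrank h'.2.ne'

theorem mk_block_eq {β γ : Ordinal.{0}} (h : β < γ) (hγ : γ < ω_ 2) :
    #{ν : OmegaTwo | ω_ 1 * β ≤ ν.1 ∧ ν.1 < ω_ 1 * γ} = ℵ_ 1 := by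
  apply le_antisymm
  · refine (Cardinal.mk_le_of_injective
      (f := fun ν : {ν : OmegaTwo | ω_ 1 * β ≤ ν.1 ∧ ν.1 < ω_ 1 * γ} =>
        (⟨ν.1.1, ν.2.2⟩ : Iio (ω_ 1 * γ))) ?_).trans (mk_Iio_le_aleph_one (omega_one_mul_lt hγ))
    intro a b hab
    exact Subtype.ext (Subtype.ext (congrArg (fun z : Iio (ω_ 1 * γ) => z.1) hab))
  · have hlt : ∀ i : Iio (ω_ 1 : Ordinal.{0}), ω_ 1 * β + i.1 < ω_ 1 * γ := by
      intro i
      have h1 : ω_ 1 * β + i.1 < ω_ 1 * β + ω_ 1 :=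
        (add_lt_add_iff_left _).2 i.2
      refine h1.trans_le ?_
      rw [← mul_add_one]
      exact omega_one_mul_le_mul (Order.add_one_le_of_lt h)
    have hcard : #(Iio (ω_ 1 : Ordinal.{0})) = ℵ_ 1 := by
      simp [Cardinal.mk_Iio_ordinal]
    rw [← hcard]
    refine Cardinal.mk_le_of_injective (f := fun i : Iio (ω_ 1 : Ordinal.{0}) =>
      (⟨⟨ω_ 1 * β + i.1, (hlt i).trans (omega_one_mul_lt hγ)⟩, le_self_add, hlt i⟩ :
        {ν : OmegaTwo | ω_ 1 * β ≤ ν.1 ∧ ν.1 < ω_ 1 * γ})) fun i j hij => ?_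
    have hij' := congrArg (fun z : {ν : OmegaTwo | ω_ 1 * β ≤ ν.1 ∧ ν.1 < ω_ 1 * γ} => z.1.1) hij
    exact Subtype.ext (add_left_cancel hij')

/-- The generators of `F(ω₁)` can be divided into `ℵ₁` levels of cardinality `ℵ₁` each. -/
theorem exists_level_function : ∃ r : Iio (ω_ 1 : Ordinal.{0}) → Ordinal.{0}, (∀ k, r k < ω_ 1) ∧
    ∀ i < ω_ 1, ℵ_ 1 ≤ #{k | r k = i} := by
  have hcard : #(Iio (ω_ 1 : Ordinal.{0})) = ℵ_ 1 := by
    simp [Cardinal.mk_Iio_ordinal]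
  have hprod : #(Iio (ω_ 1 : Ordinal.{0})) =
      #(Iio (ω_ 1 : Ordinal.{0}) × Iio (ω_ 1 : Ordinal.{0})) := by
    rw [Cardinal.mk_prod, Cardinal.lift_id, hcard,
      Cardinal.mul_eq_self (Cardinal.aleph0_le_aleph 1)]
  obtain ⟨f⟩ := Cardinal.eq.1 hprod
  refine ⟨fun k => (f k).1.1, fun k => (f k).1.2, fun i hi => ?_⟩
  rw [← hcard]
  refine Cardinal.mk_le_of_injective (f := fun j : Iio (ω_ 1 : Ordinal.{0}) =>
    (⟨f.symm (⟨i, hi⟩, j), by simp⟩ : {k | (f k).1.1 = i})) fun j j' hjj => ?_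
  have h := f.symm.injective (congrArg (fun z : {k | (f k).1.1 = i} => z.1) hjj)
  exact (Prod.mk.inj h).2

theorem mk_levels_eq {r : Iio (ω_ 1 : Ordinal.{0}) → Ordinal.{0}}
    (hr : ∀ i < ω_ 1, ℵ_ 1 ≤ #{k | r k = i}) {i j : Ordinal.{0}} (hi : i < ω_ 1) (hij : i < j) :
    #{k | i ≤ r k ∧ r k < j} = ℵ_ 1 := by
  apply le_antisymm
  · refine (Cardinal.mk_subtype_le _).trans ?_
    simp [Cardinal.mk_Iio_ordinal]
  · refine (hr i hi).trans (Cardinal.mk_le_mk_of_subset ?_)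
    rintro k rfl
    exact ⟨le_rfl, hij⟩

/-- For every block `(β, γ)`, a unitriangular family that generates the stage `ω₁ γ` over the stage
`ω₁ β`, and a bijection from the index set of this family to the generators of `F(ω₁)` whose
levels lie between the heights of `β` and `γ`. -/
structure BlockSystem (C : Ordinal.{0} → Set Ordinal.{0}) (ξ : Ordinal.{0})
    (η : OmegaTwo → ℕ → OmegaTwo) where
  /-- the level of a generator of `F(ω₁)` -/
  level : Iio (ω_ 1 : Ordinal.{0}) → Ordinal.{0}
  level_lt : ∀ k, level k < ω_ 1
  /-- the family of group elements attached to a block -/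
  vec : Ordinal.{0} → Ordinal.{0} → OmegaTwo → OmegaTwo → ℤ
  /-- the bijection with generators of `F(ω₁)` attached to a block -/
  gen : Ordinal.{0} → Ordinal.{0} → OmegaTwo → Iio (ω_ 1 : Ordinal.{0})
  unitriangular : ∀ β γ, IsBlock C ξ β γ → IsUnitriangular (vec β γ) univ
  mem : ∀ β γ, IsBlock C ξ β γ → ∀ ν : OmegaTwo, ν.1 < ω_ 1 * γ →
    vec β γ ν ∈ filtrationGroup (levelSet C ξ) η (ω_ 1 * γ)
  le_sup : ∀ β γ, IsBlock C ξ β γ → filtrationGroup (levelSet C ξ) η (ω_ 1 * γ) ≤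
    filtrationGroup (levelSet C ξ) η (ω_ 1 * β) ⊔
      Submodule.span ℤ (vec β γ '' {ν | ω_ 1 * β ≤ ν.1 ∧ ν.1 < ω_ 1 * γ})
  bijOn : ∀ β γ, IsBlock C ξ β γ → BijOn (gen β γ) {ν | ω_ 1 * β ≤ ν.1 ∧ ν.1 < ω_ 1 * γ}
    {k | treeRank C β ≤ level k ∧ level k < treeRank C γ}

theorem nonempty_blockSystem (hC : IsSquareSequence C) {η : OmegaTwo → ℕ → OmegaTwo}
    (hη : IsLadderSystem (levelSet C ξ) η) : Nonempty (BlockSystem C ξ η) := by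
  obtain ⟨r, hr1, hr2⟩ := exists_level_function
  have hvec : ∀ β γ, ∃ y : OmegaTwo → OmegaTwo → ℤ, IsBlock C ξ β γ → IsUnitriangular y univ ∧
      (∀ ν : OmegaTwo, ν.1 < ω_ 1 * γ → y ν ∈ filtrationGroup (levelSet C ξ) η (ω_ 1 * γ)) ∧
      filtrationGroup (levelSet C ξ) η (ω_ 1 * γ) ≤
        filtrationGroup (levelSet C ξ) η (ω_ 1 * β) ⊔
          Submodule.span ℤ (y '' {ν | ω_ 1 * β ≤ ν.1 ∧ ν.1 < ω_ 1 * γ}) := by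
    intro β γ
    by_cases h : IsBlock C ξ β γ
    · have hγ := omega_one_mul_lt h.1.2.1
      have hβ := omega_one_mul_lt (h.lt.trans h.1.2.1)
      obtain ⟨y, h1, h2, h3⟩ := exists_isUnitriangular_generators hη
        (hC.isNonReflecting_levelSet ξ) (β := ⟨ω_ 1 * β, hβ⟩) (α := ⟨ω_ 1 * γ, hγ⟩)
        (omega_one_mul_le_mul h.lt.le) (h.notMem_levelSet hβ)
      exact ⟨y, fun _ => ⟨h1, h2, h3⟩⟩
    · exact ⟨fun _ => 0, fun h' => absurd h' h⟩
  have hgen : ∀ β γ, ∃ b : OmegaTwo → Iio (ω_ 1 : Ordinal.{0}), IsBlock C ξ β γ →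
      BijOn b {ν | ω_ 1 * β ≤ ν.1 ∧ ν.1 < ω_ 1 * γ}
        {k | treeRank C β ≤ r k ∧ r k < treeRank C γ} := by
    classical
    intro β γ
    have k₀ : Iio (ω_ 1 : Ordinal.{0}) := ⟨0, Ordinal.omega_pos 1⟩
    by_cases h : IsBlock C ξ β γ
    swap
    · exact ⟨fun _ => k₀, fun h' => absurd h' h⟩
    have hcard := (mk_block_eq h.lt h.1.2.1).trans
      (mk_levels_eq hr2 h.treeRank_lt_omega_one h.treeRank_lt).symm
    obtain ⟨f⟩ := Cardinal.eq.1 hcard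
    let b : OmegaTwo → Iio (ω_ 1 : Ordinal.{0}) := fun ν =>
      if hν : ω_ 1 * β ≤ ν.1 ∧ ν.1 < ω_ 1 * γ then (f ⟨ν, hν⟩).1 else k₀
    have hb : ∀ ν (hν : ν ∈ {ν : OmegaTwo | ω_ 1 * β ≤ ν.1 ∧ ν.1 < ω_ 1 * γ}),
        b ν = (f ⟨ν, hν⟩).1 := fun ν hν =>
      dif_pos hν
    refine ⟨b, fun _ => ⟨fun ν hν => ?_, fun ν hν ν' hν' he => ?_, fun k hk => ?_⟩⟩
    · rw [hb ν hν]
      exact (f ⟨ν, hν⟩).2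
    · rw [hb ν hν, hb ν' hν'] at he
      exact congrArg (fun z : {ν : OmegaTwo | ω_ 1 * β ≤ ν.1 ∧ ν.1 < ω_ 1 * γ} => z.1)
        (f.injective (Subtype.ext he))
    · refine ⟨(f.symm ⟨k, hk⟩).1, (f.symm ⟨k, hk⟩).2, ?_⟩
      rw [hb _ (f.symm ⟨k, hk⟩).2]
      simp
  choose y hy using hvec
  choose b hb using hgen
  exact ⟨⟨r, hr1, y, b, fun β γ h => (hy β γ h).1, fun β γ h => (hy β γ h).2.1,
    fun β γ h => (hy β γ h).2.2, hb⟩⟩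

end Branch

/-! ### Coherent bases along the branches -/

section Coherent

variable {C : Ordinal.{0} → Set Ordinal.{0}} {ξ : Ordinal.{0}} {η : OmegaTwo → ℕ → OmegaTwo}

/-- The branch of `δ` together with `δ` itself. -/
def closedBranch (C : Ordinal.{0} → Set Ordinal.{0}) (ξ δ : Ordinal.{0}) : Set Ordinal.{0} :=
  {γ | γ = δ ∨ BranchLT C ξ γ δ}

/-- The upper end of the block of `δ` that contains `ν`. -/
noncomputable def blockTop (C : Ordinal.{0} → Set Ordinal.{0}) (ξ δ : Ordinal.{0}) (ν : OmegaTwo) :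
    Ordinal.{0} :=
  sInf {γ | γ ∈ closedBranch C ξ δ ∧ ν.1 < ω_ 1 * γ}

theorem self_mem_closedBranch {δ : Ordinal.{0}} : δ ∈ closedBranch C ξ δ := Or.inl rfl

theorem blockTop_mem {δ : Ordinal.{0}} {ν : OmegaTwo} (hν : ν.1 < ω_ 1 * δ) :
    blockTop C ξ δ ν ∈ closedBranch C ξ δ ∧ ν.1 < ω_ 1 * blockTop C ξ δ ν :=
  csInf_mem (s := {γ | γ ∈ closedBranch C ξ δ ∧ ν.1 < ω_ 1 * γ}) ⟨δ, self_mem_closedBranch, hν⟩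

theorem blockTop_le {γ δ : Ordinal.{0}} {ν : OmegaTwo} (hγ : γ ∈ closedBranch C ξ δ)
    (hν : ν.1 < ω_ 1 * γ) : blockTop C ξ δ ν ≤ γ :=
  csInf_le' ⟨hγ, hν⟩

theorem le_of_mem_closedBranch {γ δ : Ordinal.{0}} (h : γ ∈ closedBranch C ξ δ) : γ ≤ δ := by
  rcases h with rfl | h
  · exact le_rfl
  · exact h.1.lt.le

theorem branchLT_of_mem_closedBranch_of_lt (hC : IsSquareSequence C) {β γ δ : Ordinal.{0}}
    (hβ : β ∈ closedBranch C ξ δ) (hγ : γ ∈ closedBranch C ξ δ) (h : β < γ) :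
    BranchLT C ξ β γ := by
  rcases hβ with rfl | hβ
  · exact absurd (le_of_mem_closedBranch hγ) (not_le.2 h)
  · rcases hγ with rfl | hγ
    · exact hβ
    · exact hβ.of_lt hC hγ h

theorem mem_closedBranch_trans (hC : IsSquareSequence C) {β γ δ : Ordinal.{0}}
    (hβ : β ∈ closedBranch C ξ γ) (hγ : γ ∈ closedBranch C ξ δ) : β ∈ closedBranch C ξ δ := by
  rcases hβ with rfl | hβ
  · exact hγ
  · rcases hγ with rfl | hγ
    · exact Or.inr hβ
    · exact Or.inr (hβ.trans hC hγ)

theorem IsBranchPoint.of_mem_closedBranch (hC : IsSquareSequence C) {γ δ : Ordinal.{0}}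
    (hδ : IsBranchPoint C ξ δ) (h : γ ∈ closedBranch C ξ δ) : IsBranchPoint C ξ γ := by
  rcases h with rfl | h
  · exact hδ
  · exact hδ.of_branchLT hC h

/-- The blocks of a point of the branch of `δ` are blocks of `δ`. -/
theorem blockTop_eq_of_mem (hC : IsSquareSequence C) {γ δ : Ordinal.{0}}
    (hγ : γ ∈ closedBranch C ξ δ) {ν : OmegaTwo} (hν : ν.1 < ω_ 1 * γ) :
    blockTop C ξ δ ν = blockTop C ξ γ ν := by
  have hle := blockTop_le hγ hν
  have hδ := blockTop_mem (C := C) (ξ := ξ) (hν.trans_le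
    (omega_one_mul_le_mul (le_of_mem_closedBranch hγ)))
  have hγ' := blockTop_mem (C := C) (ξ := ξ) hν
  apply le_antisymm
  · exact blockTop_le (mem_closedBranch_trans hC hγ'.1 hγ) hγ'.2
  · refine blockTop_le ?_ hδ.2
    rcases hle.eq_or_lt with he | hlt
    · exact Or.inl he
    · exact Or.inr (branchLT_of_mem_closedBranch_of_lt hC hδ.1 hγ hlt)

theorem lt_omega_one_mul_iff {γ ν : Ordinal.{0}} (hγ : IsSuccLimit γ) :
    ν < ω_ 1 * γ ↔ ∃ x < γ, ν < ω_ 1 * x :=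
  Ordinal.lt_mul_iff_of_isSuccLimit hγ

/-- A point at which the branch is not cofinal is the upper end of a block. -/
def IsBlockEnd (C : Ordinal.{0} → Set Ordinal.{0}) (ξ γ : Ordinal.{0}) : Prop :=
  ¬ ∀ x < γ, ∃ β, BranchLT C ξ β γ ∧ x < β

/-- Every `ν` below `ω₁ δ` lies in a block of `δ`: at the least point `t` of the closed branch with
`ν < ω₁ t` the branch is not cofinal, since `ω₁ t` is continuous in `t`. -/
theorem blockTop_spec (hC : IsSquareSequence C) {δ : Ordinal.{0}} (hδ : IsBranchPoint C ξ δ)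
    {ν : OmegaTwo} (hν : ν.1 < ω_ 1 * δ) :
    IsBlock C ξ (branchSup C ξ (blockTop C ξ δ ν)) (blockTop C ξ δ ν) ∧
      ω_ 1 * branchSup C ξ (blockTop C ξ δ ν) ≤ ν.1 := by
  obtain ⟨ht, hνt⟩ := blockTop_mem (C := C) (ξ := ξ) hν
  set t := blockTop C ξ δ ν with htdef
  have htB := hδ.of_mem_closedBranch hC ht
  have hmin : ∀ β, BranchLT C ξ β t → ¬ ν.1 < ω_ 1 * β := fun β hβ hlt =>
    absurd (blockTop_le (mem_closedBranch_trans hC (Or.inr hβ) ht) hlt) (not_le.2 hβ.1.lt)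
  have hend : IsBlockEnd C ξ t := by
    intro hcof
    obtain ⟨x, hx, hνx⟩ := (lt_omega_one_mul_iff htB.1).1 hνt
    obtain ⟨β, hβ, hxβ⟩ := hcof x hx
    exact hmin β hβ (hνx.trans (omega_one_mul_lt_mul hxβ))
  have hblock := isBlock_branchSup hC htB hend
  refine ⟨hblock, ?_⟩
  rcases hblock.2 with h0 | hlt
  · rw [h0, mul_zero]
    exact zero_le (a := ν.1)
  · exact not_lt.1 (hmin _ hlt)

theorem blockTop_eq_of_mem_block (hC : IsSquareSequence C) {δ t : Ordinal.{0}}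
    (ht : t ∈ closedBranch C ξ δ) {ν : OmegaTwo} (h1 : ω_ 1 * branchSup C ξ t ≤ ν.1)
    (h2 : ν.1 < ω_ 1 * t) : blockTop C ξ δ ν = t := by
  refine le_antisymm (blockTop_le ht h2) ?_
  by_contra hlt
  have hν := h2.trans_le (omega_one_mul_le_mul (le_of_mem_closedBranch ht))
  obtain ⟨hm, hνm⟩ := blockTop_mem (C := C) (ξ := ξ) hν
  have hle := (branchLT_of_mem_closedBranch_of_lt hC hm ht (not_le.1 hlt)).le_branchSup
  exact absurd (hνm.trans_le (omega_one_mul_le_mul hle)) (not_lt.2 h1)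

namespace BlockSystem

variable (B : BlockSystem C ξ η)

/-- The basis of the stage `ω₁ δ` obtained by putting the blocks of `δ` together. -/
noncomputable def basisVec (δ : Ordinal.{0}) (ν : OmegaTwo) : OmegaTwo → ℤ :=
  B.vec (branchSup C ξ (blockTop C ξ δ ν)) (blockTop C ξ δ ν) ν

/-- The generator of `F(ω₁)` that corresponds to the basis element at `ν` of the stage `ω₁ δ`. -/
noncomputable def basisGen (δ : Ordinal.{0}) (ν : OmegaTwo) : Iio (ω_ 1 : Ordinal.{0}) :=
  B.gen (branchSup C ξ (blockTop C ξ δ ν)) (blockTop C ξ δ ν) ν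

theorem basisVec_eq_of_mem (hC : IsSquareSequence C) {γ δ : Ordinal.{0}}
    (hγ : γ ∈ closedBranch C ξ δ) {ν : OmegaTwo} (hν : ν.1 < ω_ 1 * γ) :
    B.basisVec δ ν = B.basisVec γ ν := by
  rw [basisVec, basisVec, blockTop_eq_of_mem hC hγ hν]

theorem basisGen_eq_of_mem (hC : IsSquareSequence C) {γ δ : Ordinal.{0}}
    (hγ : γ ∈ closedBranch C ξ δ) {ν : OmegaTwo} (hν : ν.1 < ω_ 1 * γ) :
    B.basisGen δ ν = B.basisGen γ ν := by
  rw [basisGen, basisGen, blockTop_eq_of_mem hC hγ hν]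

theorem isUnitriangular_basisVec (hC : IsSquareSequence C) {δ : Ordinal.{0}}
    (hδ : IsBranchPoint C ξ δ) : IsUnitriangular (B.basisVec δ) {ν | ν.1 < ω_ 1 * δ} :=
  fun ν hν => B.unitriangular _ _ (blockTop_spec hC hδ hν).1 ν (mem_univ ν)

theorem basisVec_mem (hC : IsSquareSequence C) {δ : Ordinal.{0}}
    (hδ : IsBranchPoint C ξ δ) {ν : OmegaTwo} (hν : ν.1 < ω_ 1 * δ) :
    B.basisVec δ ν ∈ filtrationGroup (levelSet C ξ) η (ω_ 1 * δ) :=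
  filtrationGroup_mono (omega_one_mul_le_mul (le_of_mem_closedBranch (blockTop_mem hν).1))
    (B.mem _ _ (blockTop_spec hC hδ hν).1 ν (blockTop_mem hν).2)

theorem filtrationGroup_eq_span (hC : IsSquareSequence C) {δ : Ordinal.{0}}
    (hδ : IsBranchPoint C ξ δ) : filtrationGroup (levelSet C ξ) η (ω_ 1 * δ) =
      Submodule.span ℤ (B.basisVec δ '' {ν | ν.1 < ω_ 1 * δ}) := by
  refine le_antisymm ?_ (Submodule.span_le.2 ?_)
  swap
  · rintro _ ⟨ν, hν, rfl⟩
    exact B.basisVec_mem hC hδ hν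
  induction δ using WellFoundedLT.induction with
  | ind δ ih =>
  have hbranch : ∀ β, BranchLT C ξ β δ → filtrationGroup (levelSet C ξ) η (ω_ 1 * β) ≤
      Submodule.span ℤ (B.basisVec δ '' {ν | ν.1 < ω_ 1 * δ}) := by
    intro β hβ
    refine (ih β hβ.1.lt (hδ.of_branchLT hC hβ)).trans (Submodule.span_mono ?_)
    rintro _ ⟨ν, hν, rfl⟩
    exact ⟨ν, hν.trans (omega_one_mul_lt_mul hβ.1.lt), B.basisVec_eq_of_mem hC (Or.inr hβ) hν⟩
  by_cases hend : IsBlockEnd C ξ δ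
  · have hblock := isBlock_branchSup hC hδ hend
    refine (B.le_sup _ _ hblock).trans (sup_le ?_ (Submodule.span_mono ?_))
    · rcases hblock.2 with h0 | hlt
      · rw [h0, mul_zero, filtrationGroup_zero]
        exact bot_le
      · exact hbranch _ hlt
    · rintro _ ⟨ν, ⟨h1, h2⟩, rfl⟩
      refine ⟨ν, h2, ?_⟩
      rw [basisVec, blockTop_eq_of_mem_block hC self_mem_closedBranch h1 h2]
  · have hcof := not_not.1 hend
    have hlim : IsSuccLimit (ω_ 1 * δ) :=
      Ordinal.isSuccLimit_mul_left (Cardinal.isSuccLimit_omega 1) hδ.1.bot_lt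
    intro v hv
    obtain ⟨x, hx, hvx⟩ := exists_lt_mem_filtrationGroup hlim hv
    obtain ⟨x', hx', hxx'⟩ := (lt_omega_one_mul_iff hδ.1).1 hx
    obtain ⟨β, hβ, hxβ⟩ := hcof x' hx'
    exact hbranch β hβ (filtrationGroup_mono
      (hxx'.le.trans (omega_one_mul_le_mul hxβ.le)) hvx)

/-- The generators of `F(ω₁)` used at `δ` are exactly those of level below the height of `δ`. -/
theorem bijOn_basisGen (hC : IsSquareSequence C) {δ : Ordinal.{0}}
    (hδ : IsBranchPoint C ξ δ) :
    BijOn (B.basisGen δ) {ν | ν.1 < ω_ 1 * δ} {k | B.level k < treeRank C δ} := by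
  have hrank : ∀ γ ∈ closedBranch C ξ δ, treeRank C γ ≤ treeRank C δ := by
    rintro γ (rfl | h)
    · exact le_rfl
    · exact h.1.treeRank_lt.le
  have hmem : ∀ ν : OmegaTwo, ν.1 < ω_ 1 * δ →
      treeRank C (branchSup C ξ (blockTop C ξ δ ν)) ≤ B.level (B.basisGen δ ν) ∧
      B.level (B.basisGen δ ν) < treeRank C (blockTop C ξ δ ν) := fun ν hν => by
    obtain ⟨hb, hle⟩ := blockTop_spec hC hδ hν
    exact (B.bijOn _ _ hb).mapsTo ⟨hle, (blockTop_mem hν).2⟩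
  refine ⟨fun ν hν => (hmem ν hν).2.trans_le (hrank _ (blockTop_mem hν).1), ?_, ?_⟩
  · have hlt : ∀ ν ν' : OmegaTwo, ν.1 < ω_ 1 * δ → ν'.1 < ω_ 1 * δ →
        blockTop C ξ δ ν < blockTop C ξ δ ν' → B.basisGen δ ν ≠ B.basisGen δ ν' := by
      intro ν ν' hν hν' h he
      have hbr := branchLT_of_mem_closedBranch_of_lt hC (blockTop_mem (C := C) (ξ := ξ) hν).1
        (blockTop_mem hν').1 h
      have hle : treeRank C (blockTop C ξ δ ν) ≤
          treeRank C (branchSup C ξ (blockTop C ξ δ ν')) := by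
        rcases hbr.le_branchSup.eq_or_lt with h1 | h1
        · exact le_of_eq (congrArg _ h1)
        · rcases (blockTop_spec hC hδ hν').1.2 with h2 | h2
          · rw [h2] at h1
            exact absurd h1 not_lt_zero
          · exact (hC.treeLT_of_lt hbr.1 h2.1 h1).treeRank_lt.le
      have h1 := ((hmem ν hν).2.trans_le hle).trans_le (hmem ν' hν').1
      rw [he] at h1
      exact lt_irrefl _ h1
    intro ν hν ν' hν' he
    rcases lt_trichotomy (blockTop C ξ δ ν) (blockTop C ξ δ ν') with h | h | h
    · exact absurd he (hlt ν ν' hν hν' h)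
    · obtain ⟨hb, hle⟩ := blockTop_spec hC hδ hν
      obtain ⟨-, hle'⟩ := blockTop_spec hC hδ hν'
      rw [basisGen, basisGen, ← h] at he
      rw [← h] at hle'
      refine (B.bijOn _ _ hb).injOn ⟨hle, (blockTop_mem hν).2⟩ ⟨hle', ?_⟩ he
      rw [h]
      exact (blockTop_mem hν').2
    · exact absurd he.symm (hlt ν' ν hν' hν h)
  · intro k hk
    have hne : {γ | γ ∈ closedBranch C ξ δ ∧ B.level k < treeRank C γ}.Nonempty :=
      ⟨δ, self_mem_closedBranch, hk⟩
    obtain ⟨ht, hkt⟩ := csInf_mem hne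
    set t := sInf {γ | γ ∈ closedBranch C ξ δ ∧ B.level k < treeRank C γ} with htdef
    have htB := hδ.of_mem_closedBranch hC ht
    have hmin : ∀ β, BranchLT C ξ β t → ¬ B.level k < treeRank C β := fun β hβ hlt => by
      have hβm : β ∈ {γ | γ ∈ closedBranch C ξ δ ∧ B.level k < treeRank C γ} :=
        ⟨mem_closedBranch_trans hC (Or.inr hβ) ht, hlt⟩
      exact absurd (csInf_le' hβm) (not_le.2 hβ.1.lt)
    have hend : IsBlockEnd C ξ t := by
      intro hcof
      obtain ⟨β, hβ, hkβ⟩ := exists_le_treeRank_of_lt hkt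
      obtain ⟨β', hβ', hlt⟩ := hcof β hβ.lt
      exact hmin β' hβ' (hkβ.trans_lt (hC.treeLT_of_lt hβ hβ'.1 hlt).treeRank_lt)
    have hblock := isBlock_branchSup hC htB hend
    have hle : treeRank C (branchSup C ξ t) ≤ B.level k := by
      rcases hblock.2 with h0 | hlt
      · rw [h0, treeRank_zero]
        exact zero_le (a := B.level k)
      · exact not_lt.1 (hmin _ hlt)
    obtain ⟨ν, ⟨h1, h2⟩, hν⟩ := (B.bijOn _ _ hblock).surjOn ⟨hle, hkt⟩
    refine ⟨ν, h2.trans_le (omega_one_mul_le_mul (le_of_mem_closedBranch ht)), ?_⟩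
    rw [basisGen, blockTop_eq_of_mem_block hC ht h1 h2, hν]

end BlockSystem

end Coherent

/-! ### Player `∀` has no winning strategy -/

/-- The pairs of images of the elements of a subgroup under two homomorphisms that are injective
on it form a partial isomorphism. The second one may take its values in a larger group. -/
theorem isPartialIso_of_injOn {A B B' K : Type*} [AddCommGroup A] [AddCommGroup B]
    [AddCommGroup B'] [AddCommGroup K] (D : AddSubgroup K) {f : K →+ A} {g : K →+ B'} {j : B →+ B'}
    (hf : InjOn f D) (hg : InjOn g D) (hj : Function.Injective j) :
    EFGame.IsPartialIso groupLang {p : A × B | ∃ c ∈ D, f c = p.1 ∧ g c = j p.2} := by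
  refine ⟨?_, ?_⟩
  · rintro p ⟨c, hc, h1, h2⟩ q ⟨d, hd, h3, h4⟩
    rw [← h1, ← h3, hf.eq_iff hc hd, ← hj.eq_iff, ← h2, ← h4, hg.eq_iff hc hd]
  · intro n R a b hab
    cases R with
    | add =>
      obtain ⟨c₀, hc₀, h1, h2⟩ := hab 0
      obtain ⟨c₁, hc₁, h3, h4⟩ := hab 1
      obtain ⟨c₂, hc₂, h5, h6⟩ := hab 2
      change a 0 + a 1 = a 2 ↔ b 0 + b 1 = b 2
      simp only at h1 h2 h3 h4 h5 h6
      rw [← hj.eq_iff, map_add, ← h1, ← h2, ← h3, ← h4, ← h5, ← h6, ← map_add, ← map_add,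
        hf.eq_iff (add_mem hc₀ hc₁) hc₂, hg.eq_iff (add_mem hc₀ hc₁) hc₂]

section Coherent

variable {C : Ordinal.{0} → Set Ordinal.{0}} {ξ : Ordinal.{0}} {η : OmegaTwo → ℕ → OmegaTwo}

/-- Coefficient functions supported below `ω₁ δ`. -/
noncomputable def supportedBelow (δ : Ordinal.{0}) : AddSubgroup (OmegaTwo →₀ ℤ) :=
  (Finsupp.supported ℤ ℤ {ν : OmegaTwo | ν.1 < ω_ 1 * δ}).toAddSubgroup

theorem mem_supportedBelow {δ : Ordinal.{0}} {c : OmegaTwo →₀ ℤ} :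
    c ∈ supportedBelow δ ↔ ∀ ν ∈ c.support, ν.1 < ω_ 1 * δ := by
  exact Finsupp.mem_supported ℤ c

namespace BlockSystem

variable (B : BlockSystem C ξ η)

/-- The homomorphism to `F(ω₁)` that maps the unit at `ν` to the generator `basisGen δ ν`. -/
noncomputable def toFree (δ : Ordinal.{0}) : (OmegaTwo →₀ ℤ) →+ FreeAb (ω_ 1) :=
  (FreeAbelianGroup.equivFinsupp (Iio (ω_ 1 : Ordinal.{0}))).symm.toAddMonoidHom.comp
    (Finsupp.mapDomain.addMonoidHom (B.basisGen δ))

theorem toFree_apply (δ : Ordinal.{0}) (c : OmegaTwo →₀ ℤ) :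
    B.toFree δ c = (FreeAbelianGroup.equivFinsupp (Iio (ω_ 1 : Ordinal.{0}))).symm
      (Finsupp.mapDomain (B.basisGen δ) c) :=
  rfl

/-- The homomorphism to `ℤ^{ω₂}` that maps the unit at `ν` to the vector `basisVec δ ν`. -/
noncomputable def toVec (δ : Ordinal.{0}) : (OmegaTwo →₀ ℤ) →+ (OmegaTwo → ℤ) :=
  (Finsupp.linearCombination ℤ (B.basisVec δ)).toAddMonoidHom

theorem toVec_apply (δ : Ordinal.{0}) (c : OmegaTwo →₀ ℤ) :
    B.toVec δ c = c.sum fun ν a => a • B.basisVec δ ν :=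
  rfl

/-- The partial isomorphism between `F(ω₁)` and the stage `ω₁ δ` of the ladder group given by the
correspondence of bases. -/
def partialIso (δ : Ordinal.{0}) : Set (FreeAb (ω_ 1) × ladderGroup (levelSet C ξ) η) :=
  {p | ∃ c ∈ supportedBelow δ, B.toFree δ c = p.1 ∧
    B.toVec δ c = (ladderGroup (levelSet C ξ) η).subtype p.2}

theorem injOn_toFree (hC : IsSquareSequence C) {δ : Ordinal.{0}} (hδ : IsBranchPoint C ξ δ) :
    InjOn (B.toFree δ) (supportedBelow δ) := by
  intro c hc d hd h
  have h' := (FreeAbelianGroup.equivFinsupp (Iio (ω_ 1 : Ordinal.{0}))).symm.injective h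
  exact Finsupp.mapDomain_injOn _ (B.bijOn_basisGen hC hδ).injOn
    (mem_supportedBelow.1 hc) (mem_supportedBelow.1 hd) h'

theorem injOn_toVec (hC : IsSquareSequence C) {δ : Ordinal.{0}} (hδ : IsBranchPoint C ξ δ) :
    InjOn (B.toVec δ) (supportedBelow δ) := by
  intro c hc d hd h
  have hcd := mem_supportedBelow.1 (sub_mem hc hd)
  have h0 : B.toVec δ (c - d) = 0 := by rw [map_sub, h, sub_self]
  have h0' : ((c - d).sum fun ν a => a • B.basisVec δ ν) = 0 := h0
  ext ν
  have := (B.isUnitriangular_basisVec hC hδ).dvd_coeff (c - d) hcd 0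
    (fun i _ => by rw [h0']; simp) ν
  rw [zero_dvd_iff, Finsupp.sub_apply, sub_eq_zero] at this
  exact this

theorem isPartialIso_partialIso (hC : IsSquareSequence C) {δ : Ordinal.{0}}
    (hδ : IsBranchPoint C ξ δ) : EFGame.IsPartialIso groupLang (B.partialIso δ) :=
  isPartialIso_of_injOn (supportedBelow δ) (B.injOn_toFree hC hδ) (B.injOn_toVec hC hδ)
    Subtype.val_injective

theorem toFree_eq_of_mem (hC : IsSquareSequence C) {γ δ : Ordinal.{0}}
    (hγ : γ ∈ closedBranch C ξ δ) {c : OmegaTwo →₀ ℤ} (hc : c ∈ supportedBelow γ) :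
    B.toFree δ c = B.toFree γ c := by
  have : Finsupp.mapDomain (B.basisGen δ) c = Finsupp.mapDomain (B.basisGen γ) c :=
    Finsupp.mapDomain_congr fun ν hν => B.basisGen_eq_of_mem hC hγ (mem_supportedBelow.1 hc ν hν)
  rw [toFree_apply, toFree_apply, this]

theorem toVec_eq_of_mem (hC : IsSquareSequence C) {γ δ : Ordinal.{0}}
    (hγ : γ ∈ closedBranch C ξ δ) {c : OmegaTwo →₀ ℤ} (hc : c ∈ supportedBelow γ) :
    B.toVec δ c = B.toVec γ c := by
  rw [toVec_apply, toVec_apply]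
  exact Finsupp.sum_congr fun ν hν => by
    rw [B.basisVec_eq_of_mem hC hγ (mem_supportedBelow.1 hc ν hν)]

theorem partialIso_mono (hC : IsSquareSequence C) {γ δ : Ordinal.{0}}
    (hγ : γ ∈ closedBranch C ξ δ) : B.partialIso γ ⊆ B.partialIso δ := by
  rintro p ⟨c, hc, h1, h2⟩
  refine ⟨c, mem_supportedBelow.2 fun ν hν => (mem_supportedBelow.1 hc ν hν).trans_le
    (omega_one_mul_le_mul (le_of_mem_closedBranch hγ)), ?_, ?_⟩
  · rw [B.toFree_eq_of_mem hC hγ hc, h1]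
  · rw [B.toVec_eq_of_mem hC hγ hc, h2]

/-- If the branch of `δ` is cofinal, its partial isomorphism is the union of those along the
branch. -/
theorem exists_mem_partialIso (hC : IsSquareSequence C) {δ : Ordinal.{0}}
    (hδ : IsBranchPoint C ξ δ) (hcof : ∀ x < δ, ∃ β, BranchLT C ξ β δ ∧ x < β)
    {p : FreeAb (ω_ 1) × ladderGroup (levelSet C ξ) η} (hp : p ∈ B.partialIso δ) :
    ∃ γ, BranchLT C ξ γ δ ∧ p ∈ B.partialIso γ := by
  obtain ⟨c, hc, h1, h2⟩ := hp
  have hex : ∀ s : Finset OmegaTwo, (∀ ν ∈ s, ν.1 < ω_ 1 * δ) →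
      ∃ x < δ, ∀ ν ∈ s, ν.1 < ω_ 1 * x := by
    classical
    intro s
    induction s using Finset.induction_on with
    | empty => exact fun _ => ⟨0, hδ.1.bot_lt, fun ν hν => absurd hν (Finset.notMem_empty ν)⟩
    | insert a s _ ih =>
      intro hs
      obtain ⟨x, hx, hxs⟩ := ih fun ν hν => hs ν (Finset.mem_insert_of_mem hν)
      obtain ⟨y, hy, hay⟩ := (lt_omega_one_mul_iff hδ.1).1 (hs a (Finset.mem_insert_self a s))
      refine ⟨max x y, max_lt hx hy, fun ν hν => ?_⟩
      rcases Finset.mem_insert.1 hν with rfl | hν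
      · exact hay.trans_le (omega_one_mul_le_mul (le_max_right x y))
      · exact (hxs ν hν).trans_le (omega_one_mul_le_mul (le_max_left x y))
  obtain ⟨x, hx, hxc⟩ := hex c.support (mem_supportedBelow.1 hc)
  obtain ⟨γ, hγ, hxγ⟩ := hcof x hx
  have hcγ : c ∈ supportedBelow γ := mem_supportedBelow.2 fun ν hν =>
    (hxc ν hν).trans (omega_one_mul_lt_mul hxγ)
  refine ⟨γ, hγ, c, hcγ, ?_, ?_⟩
  · rw [← B.toFree_eq_of_mem hC (Or.inr hγ) hcγ, h1]
  · rw [← B.toVec_eq_of_mem hC (Or.inr hγ) hcγ, h2]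

theorem stageSet_subset_field (hC : IsSquareSequence C) (hη : IsLadderSystem (levelSet C ξ) η)
    {δ : Ordinal.{0}} (hδ : IsBranchPoint C ξ δ) (hrank : ω_ 1 ≤ treeRank C δ) :
    stageSet (levelSet C ξ) η (ω_ 1 * δ) ⊆ EFGame.field (B.partialIso δ) := by
  have hlim : ∀ ε ∈ levelSet C ξ, IsSuccLimit ε.1 := fun ε hε =>
    isSuccLimit_of_cof_eq_aleph0 hε.1
  have hG := ladderGroup_eq_filtrationGroup hη (hC.isNonReflecting_levelSet ξ) hlim
  have hspan := B.filtrationGroup_eq_span hC hδ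
  rintro (a | g) hx
  · rw [EFGame.inl_mem_field]
    have hk : ∀ k, ∃ ν : OmegaTwo, ν.1 < ω_ 1 * δ ∧ B.basisGen δ ν = k := fun k =>
      (B.bijOn_basisGen hC hδ).surjOn (show B.level k < treeRank C δ from
        (B.level_lt k).trans_le hrank)
    choose s hs hsk using hk
    let l := FreeAbelianGroup.equivFinsupp (Iio (ω_ 1 : Ordinal.{0})) a
    let c := Finsupp.mapDomain s l
    have hc : c ∈ supportedBelow δ := by
      classical
      refine mem_supportedBelow.2 fun ν hν => ?_
      obtain ⟨k, -, rfl⟩ := Finset.mem_image.1 (Finsupp.mapDomain_support hν)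
      exact hs k
    have hvec : B.toVec δ c ∈ filtrationGroup (levelSet C ξ) η (ω_ 1 * δ) :=
      Submodule.sum_mem _ fun ν hν => Submodule.smul_mem _ _
        (B.basisVec_mem hC hδ (mem_supportedBelow.1 hc ν hν))
    refine ⟨⟨B.toVec δ c, hG.ge (filtrationGroup_mono (omega_one_mul_lt hδ.2.1).le hvec)⟩,
      c, hc, ?_, rfl⟩
    have hl : Finsupp.mapDomain (B.basisGen δ) c = l := by
      rw [← Finsupp.mapDomain_comp, show B.basisGen δ ∘ s = id from funext hsk,
        Finsupp.mapDomain_id]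
    change (FreeAbelianGroup.equivFinsupp _).symm (Finsupp.mapDomain (B.basisGen δ) c) = a
    rw [hl]
    exact (FreeAbelianGroup.equivFinsupp _).symm_apply_apply a
  · rw [EFGame.inr_mem_field]
    have hg := inr_mem_stageSet.1 hx
    rw [hspan, Finsupp.mem_span_image_iff_linearCombination] at hg
    obtain ⟨c, hc, hcg⟩ := hg
    exact ⟨B.toFree δ c, c, hc, rfl, hcg⟩

end BlockSystem

/-- Points of cofinality `ω₁` have cofinal branches. -/
theorem IsSquareSequence.exists_gt_branchLT (hC : IsSquareSequence C) (hξ : ξ < ω_ 1)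
    {δ x : Ordinal.{0}} (hδ2 : δ < ω_ 2) (hcof : δ.cof = ℵ_ 1) (hx : x < δ) :
    ∃ β, BranchLT C ξ β δ ∧ x < β := by
  obtain ⟨β, hβ, hξβ⟩ := hC.exists_lt_treeRank hδ2 hcof hξ
  obtain ⟨γ, hγ, hlt, -⟩ := hC.exists_gt_treeLT hδ2 hcof (max_lt hx hβ.lt)
  have hβγ := (le_max_right x β).trans_lt hlt
  exact ⟨γ, ⟨hγ, hξβ.trans (hC.treeLT_of_lt hβ hγ hβγ).treeRank_lt⟩,
    (le_max_left x β).trans_lt hlt⟩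

/-- `∀` has no winning strategy: for some `δ` of cofinality `ω₁`, `∃` follows the isomorphism
between `F(ω₁)` and the stage `ω₁ δ`. There are only `ℵ₁` partial isomorphisms attached to points
below `δ`, so `δ` can be closed under the moves of `∀` against all of them, without any cardinal
arithmetic. -/
theorem IsSquareSequence.not_forallWins (hC : IsSquareSequence C) (hξ : ξ < ω_ 1)
    (hη : IsLadderSystem (levelSet C ξ) η) :
    ¬ EFGame.ForallWins groupLang (ω_ 1 : Ordinal.{0}) (FreeAb (ω_ 1))
      (ladderGroup (levelSet C ξ) η) := by
  obtain ⟨B⟩ := nonempty_blockSystem hC hη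
  have hlim : ∀ ε ∈ levelSet C ξ, IsSuccLimit ε.1 := fun ε hε =>
    isSuccLimit_of_cof_eq_aleph0 hε.1
  have hNR := hC.isNonReflecting_levelSet ξ
  refine EFGame.not_forallWins_of_countably_directed
    (ι := {δ : Ordinal.{0} // IsBranchPoint C ξ δ}) (fun δ => B.partialIso δ.1)
    (fun δ => B.isPartialIso_partialIso hC δ.2) fun X => ?_
  choose ρ hρ using exists_mem_stageSet hη hNR hlim
  have hg : ∀ γ : OmegaTwo, ∃ β : OmegaTwo, ∀ h : IsBranchPoint C ξ γ.1,
      ∀ α, X ⟨γ.1, h⟩ α ∈ stageSet (levelSet C ξ) η β.1 := by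
    intro γ
    by_cases h : IsBranchPoint C ξ γ.1
    · obtain ⟨β, hβ, hlt⟩ := exists_bound_lt_omega_two
        ((mk_Iio_le_aleph_one omega_one_lt_omega_two).trans_lt aleph_one_lt_aleph_two)
        (fun α => (ρ (X ⟨γ.1, h⟩ α)).1) fun α => (ρ (X ⟨γ.1, h⟩ α)).2
      exact ⟨⟨β, hβ⟩, fun _ α => stageSet_mono (hlt α).le (hρ _)⟩
    · exact ⟨γ, fun h' => absurd h' h⟩
  choose g hg using hg
  obtain ⟨δ, hδg, hδcof⟩ := (isClub_closurePoints g).exists_cof_eq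
    (Cardinal.isSuccLimit_omega 1) omega_one_lt_omega_two
  rw [Cardinal.cof_omega_one] at hδcof
  have hcofinal : ∀ x < δ.1, ∃ β, BranchLT C ξ β δ.1 ∧ x < β := fun x hx =>
    hC.exists_gt_branchLT hξ δ.2 hδcof hx
  have hδlim : IsSuccLimit δ.1 := by
    rw [← Ordinal.one_lt_cof_iff, hδcof]
    exact Cardinal.one_lt_aleph0.trans_le (Cardinal.aleph0_le_aleph 1)
  have hrank : ω_ 1 ≤ treeRank C δ.1 := by
    by_contra hlt
    obtain ⟨β, hβ, hβlt⟩ := hC.exists_lt_treeRank δ.2 hδcof (not_le.1 hlt)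
    exact absurd hβ.treeRank_lt (not_lt.2 hβlt.le)
  have hδ : IsBranchPoint C ξ δ.1 := ⟨hδlim, δ.2, hξ.trans_le hrank, fun β hβ =>
    hC.treeRank_lt_omega_one (hC.countable_treeLT_of_treeLT hδcof hβ)⟩
  refine ⟨⟨δ.1, hδ⟩, {γ | BranchLT C ξ γ.1 δ.1}, fun γ hγ => B.partialIso_mono hC (Or.inr hγ),
    fun T hT hTc => ?_, fun γ hγ α => ?_⟩
  · -- countably many points of the branch are bounded on the branch
    have hstep : ∀ x : T, ∃ γ, BranchLT C ξ γ δ.1 ∧ x.1 ∈ EFGame.field (B.partialIso γ) := by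
      rintro ⟨x, hx⟩
      obtain ⟨y, p, hp, hxy⟩ := hT hx
      obtain ⟨γ, hγ, hpγ⟩ := B.exists_mem_partialIso hC hδ hcofinal hp
      exact ⟨γ, hγ, y, p, hpγ, hxy⟩
    choose f hf hfx using hstep
    have hsup : sSup (range f) < δ.1 := by
      apply Ordinal.sSup_lt_of_lt_cof
      · rw [← Ordinal.lift_cof, hδcof]
        have := hTc.to_subtype
        refine (Cardinal.le_aleph0_iff_set_countable.2 (countable_range f)).trans_lt ?_
        simp
      · rintro _ ⟨x, rfl⟩
        exact (hf x).1.lt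
    obtain ⟨γ, hγ, hlt⟩ := hcofinal _ hsup
    refine ⟨⟨γ, hδ.of_branchLT hC hγ⟩, hγ, fun x hx => ?_⟩
    have hbdd : BddAbove (range f) := by
      refine ⟨δ.1, ?_⟩
      rintro _ ⟨y, rfl⟩
      exact (hf y).1.lt.le
    have hle : f ⟨x, hx⟩ < γ := (le_csSup hbdd (mem_range_self _)).trans_lt hlt
    obtain ⟨y, hy⟩ := hfx ⟨x, hx⟩
    exact ⟨y, hy.mono (B.partialIso_mono hC (Or.inr ((hf ⟨x, hx⟩).of_lt hC hγ hle)))⟩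
  · have hγδ : γ.1 < δ.1 := hγ.1.lt
    have hlt : (g ⟨γ.1, γ.2.2.1⟩).1 < δ.1 := hδg ⟨γ.1, γ.2.2.1⟩ hγδ
    refine B.stageSet_subset_field hC hη hδ hrank (stageSet_mono ?_ (hg ⟨γ.1, γ.2.2.1⟩ γ.2 α))
    exact hlt.le.trans (Ordinal.le_mul_right _ (Ordinal.omega_pos 1))

end Coherent

theorem theorem1 (hsquare : SquareOmegaOne) :
    ∃ (E : Set OmegaTwo) (η : OmegaTwo → ℕ → OmegaTwo),
      (∀ δ ∈ E, (δ : Ordinal.{0}).cof = ℵ₀) ∧ IsStationary E ∧ IsNonReflecting E ∧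
      IsLadderSystem E η ∧
      #(ladderGroup E η) = ℵ_ 2 ∧
      IsAlmostFree (ladderGroup E η) ∧
      ¬ EFGame.Determined groupLang (ω_ 1 : Ordinal.{0}) (FreeAb (ω_ 1)) (ladderGroup E η) := by
  obtain ⟨C, hC⟩ := hsquare
  have hC : IsSquareSequence C := hC
  obtain ⟨ξ, hst⟩ := hC.exists_isStationary_levelSet
  have hcof : ∀ δ ∈ levelSet C ξ, δ.1.cof = ℵ₀ := fun δ hδ => hδ.1
  have hlim : ∀ δ ∈ levelSet C ξ, IsSuccLimit δ.1 := fun δ hδ =>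
    isSuccLimit_of_cof_eq_aleph0 hδ.1
  have hξ : ξ < ω_ 1 := by
    obtain ⟨γ, hγ⟩ := hst.nonempty
    rw [← hγ.2.2]
    exact hC.treeRank_lt_omega_one (hC.countable_treeLT_of_cof_eq_aleph0 hγ.1)
  have hNR := hC.isNonReflecting_levelSet ξ
  obtain ⟨η, hη⟩ := exists_isLadderSystem hcof
  refine ⟨levelSet C ξ, η, hcof, hst, hNR, hη, mk_ladderGroup hη hNR hlim,
    isAlmostFree_ladderGroup hη hNR hlim, ?_⟩
  rintro (h | h)
  · exact not_existsWins hη hNR hlim hst h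
  · exact hC.not_forallWins hξ hη h
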